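/- Let $R$ be a commutative $\mathbb{Q}$-algebra of functions of the times $t=(t_1\equiv x,t_2,\dots)$ and $\bar t=(\bar t_1,\bar t_2,\dots)$, i.e. carrying pairwise commuting derivations $\partial/\partial t_r$, $\partial/\partial\bar t_s$ ($r,s\ge1$). Write $\partial=\partial/\partial t_1$, $\bar\partial=\partial/\partial\bar t_1$, and $D$, $\bar D$ for these derivations as operators. For a pseudo-differential operator $A$, $A_+$ and $A_-$ are its differential and purely pseudo-differential parts, $A^*$ is its formal adjoint, and $A(f)$ is the action on a function; $\partial_{t_r}A$ differentiates coefficients. *KP system.* Let $\mathcal L=WDW^{-1}$ with $W=1+\sum_{l\ge1}w_lD^{-l}$ and $\partial_{t_r}W=-(\mathcal L^r)_-W$. Let $\Phi_j$ and $\Psi_j$ ($j\ge1$) be eigenfunctions and adjoint eigenfunctions of $\mathcal L$: $\partial_{t_r}\Phi_j=(\mathcal L^r)_+(\Phi_j)$, $\partial_{t_r}\Psi_j=-((\mathcal L^*)^r)_+(\Psi_j)$. Assume that the Wronskians in $\partial$, $W_k=W_k[\Phi_1,\dots,\Phi_k]$ and $\mathcal W_k=W_k[\Psi_1,\dots,\Psi_k]$,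 are invertible for all $k\ge 1$ ($W_0=\mathcal W_0=1$), and put $\mathcal W_k(G)=W_{k+1}[\Psi_1,\dots,\Psi_k,G]$. *Ghost flows.* Let $\mathcal M_s=\sum_{j=1}^s\Phi_{s-j+1}D^{-1}\Psi_j$, and assume, for given primitives $\partial^{-1}(\Phi_k\Psi_j)\in R$ with respect to $\partial$, that $\partial_{\bar t_s}W=\mathcal M_sW$, $$\partial_{\bar t_s}\Phi_k=\sum_{j=1}^s\Phi_{s-j+1}\,\partial^{-1}(\Psi_j\Phi_k)-\Phi_{k+s},\qquad \partial_{\bar t_s}\Psi_k=\sum_{j=1}^s\Psi_j\,\partial^{-1}(\Phi_{s-j+1}\Psi_k)+\Psi_{k+s}.$$ A *generic eigenfunction* of $\mathcal L$ is $F\in R$ with $\partial_{t_r}F=(\mathcal L^r)_+(F)$ for all $r\ge1$ and, for some primitives $\partial^{-1}(\Psi_jF)\in R$, $\partial_{\bar t_s}F=\mathcal M_s(F):=\sum_{j=1}^s\Phi_{s-j+1}\partial^{-1}(\Psi_jF)$ for all $s\ge1$. *Ghost Lax operator.* For $s\ge1$ put $$\bar M_s=\sum_{j=1}^s\Bigl(\sum_{k=j}^s\frac{\Phi_{s-k+1}}{\Phi_1}\frac{\mathcal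 W_{j-1}(\Psi_k)}{\mathcal W_j}\Bigr)\Bigl(\bar D-\bar\partial\ln\frac{\mathcal W_{j-1}}{\mathcal W_{j-2}}\Bigr)\cdots(\bar D-\bar\partial\ln\Psi_1)\Bigl(\bar D-\bar\partial\ln\frac1{\Phi_1}\Bigr)-\partial_{\bar t_s}\ln\Phi_1$$ ($j$ first-order factors in the $j$-th term). **Proposition.** There is exactly one operator $\bar{\mathcal L}=\bar D+O(\bar D^{-1})$ with $(\bar{\mathcal L}^s)_+=\bar M_s$ for all $s\ge1$. There are functions $\bar\Phi_l,\bar\Psi_j\in R$ ($l,j\ge1$) of the form $\bar\Phi_1=1/\Phi_1$, $$\bar\Phi_l=(-1)^l\frac1{\Phi_1}\bar\partial^{-1}\Phi_1\Psi_1\,\bar\partial^{-1}\frac{\mathcal W_2}{\Psi_1^2}\,\bar\partial^{-1}\frac{\mathcal W_3\Psi_1}{\mathcal W_2^2}\cdots\bar\partial^{-1}\frac{\mathcal W_{l-1}\mathcal W_{l-3}}{\mathcal W_{l-2}^2}\ (l\ge2),$$ $$\bar\Psi_j=(-1)^{j-1}\frac{W_2}{\Phi_1}\bar\partial^{-1}\frac{W_3\Phi_1}{W_2^2}\,\bar\partial^{-1}\cdots\bar\partial^{-1}\frac{W_{j+1}W_{j-1}}{W_j^2}\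 (j\ge1)$$ (for $l=2$ the product is $\bar\partial^{-1}\Phi_1\Psi_1$, for $j=1$ it is $W_2/\Phi_1$), for a suitable choice of the primitives $\bar\partial^{-1}$ in $R$, those in $\bar\Phi_l$ being such that $W=1+\sum_{l\ge1}\Phi_1\bar\Phi_{l+1}D^{-l}$, with the following properties. The $\bar\Phi_l$ and $\bar\Psi_j$ are eigenfunctions and adjoint eigenfunctions of $\bar{\mathcal L}$ with respect to the times $\bar t_s$. With $\bar{\mathcal M}_r=\sum_{i=1}^r\bar\Phi_{r-i+1}\bar D^{-1}\bar\Psi_i$, for all $r,s\ge1$, $$\partial_{t_r}\mathcal L=[(\mathcal L^r)_+,\mathcal L],\quad \partial_{\bar t_s}\mathcal L=[\mathcal M_s,\mathcal L],\quad \partial_{\bar t_s}\bar{\mathcal L}=[(\bar{\mathcal L}^s)_+,\bar{\mathcal L}],\quad \partial_{t_r}\bar{\mathcal L}=[\bar{\mathcal M}_r,\bar{\mathcal L}].$$ Call $\bar F\in R$ a generic eigenfunction of $\bar{\mathcal L}$ if $\partial_{\bar t_s}\bar F=(\bar{\mathcal L}^s)_+(\bar F)$ for all $s\ge1$ and, for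 some primitives $\bar\partial^{-1}(\bar\Psi_i\bar F)\in R$, $\partial_{t_r}\bar F=\bar{\mathcal M}_r(\bar F):=\sum_{i=1}^r\bar\Phi_{r-i+1}\bar\partial^{-1}(\bar\Psi_i\bar F)$ for all $r\ge1$. If $F$ is a generic eigenfunction of $\mathcal L$, then $F/\Phi_1$ is one of $\bar{\mathcal L}$; in particular $$\partial_{t_r}F=(\mathcal L^r)_+(F),\qquad \partial_{\bar t_s}F=\mathcal M_s(F),\qquad \partial_{\bar t_s}(F/\Phi_1)=(\bar{\mathcal L}^s)_+(F/\Phi_1).$$ If $\bar F$ is a generic eigenfunction of $\bar{\mathcal L}$, then $\Phi_1\bar F$ is one of $\mathcal L$; in particular $$\partial_{\bar t_s}\bar F=(\bar{\mathcal L}^s)_+(\bar F),\qquad \partial_{t_r}\bar F=\bar{\mathcal M}_r(\bar F),\qquad \partial_{t_r}(\Phi_1\bar F)=(\mathcal L^r)_+(\Phi_1\bar F).$$ -/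

import Mathlib

/-!
Functions of the times `t₁ = x, t₂, …` and `t̄₁, t̄₂, …` are the elements of a commutative ring `R`
carrying derivations `∂/∂t_r`, `∂/∂t̄_s`. Sequences `Φ : ℕ → R`, `∂ : ℕ → Derivation ℤ R R`, …
are indexed as in the mathematics, starting at `1`; their value at `0` is never used.
-/

namespace DoubleKP

variable {R : Type*} [CommRing R]

/-! ### Pseudo-differential operators -/

/-- Sequences of coefficients `(aₙ)`, `n ∈ ℤ`, that vanish for all large `n`. -/
def symbols (R : Type*) [CommRing R] : AddSubgroup (ℤ → R) where
  carrier := {a | ∃ N : ℤ, ∀ n, N < n → a n = 0}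
  zero_mem' := ⟨0, fun _ _ => rfl⟩
  add_mem' := by
    rintro a b ⟨M, hM⟩ ⟨N, hN⟩
    refine ⟨max M N, fun n hn => ?_⟩
    simp [hM n (lt_of_le_of_lt (le_max_left _ _) hn), hN n (lt_of_le_of_lt (le_max_right _ _) hn)]
  neg_mem' := by
    rintro a ⟨M, hM⟩
    exact ⟨M, fun n hn => by simp [hM n hn]⟩

/-- Formal pseudo-differential operators `∑_{n ≤ N} aₙ Dⁿ` with coefficients in `R`, where `D` is
the derivation `d` regarded as an operator. -/
def PDO (_d : Derivation ℤ R R) : Type _ := symbols R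

namespace PDO

variable {d : Derivation ℤ R R}

instance : AddCommGroup (PDO d) := inferInstanceAs (AddCommGroup (symbols R))

/-- The coefficient of `Dⁿ`. -/
def coeff (A : PDO d) (n : ℤ) : R := (show symbols R from A).val n

theorem exists_bound (A : PDO d) : ∃ N : ℤ, ∀ n, N < n → A.coeff n = 0 :=
  (show symbols R from A).property

/-- The operator with given coefficients. -/
def mk (a : ℤ → R) (h : ∃ N : ℤ, ∀ n, N < n → a n = 0) : PDO d := (⟨a, h⟩ : symbols R)

/-- The operator `f Dᵐ`. -/
def monomial (m : ℤ) (f : R) : PDO d :=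
  mk (fun n => if n = m then f else 0) ⟨m, fun n hn => if_neg (by omega)⟩

/-- The operator of multiplication by `f`. -/
def mulOp (f : R) : PDO d := monomial 0 f

/-- `D`. -/
def D : PDO d := monomial 1 1

/-- `D⁻¹`. -/
def Dinv : PDO d := monomial (-1) 1

instance : One (PDO d) := ⟨mulOp 1⟩

/-- The product of operators, from the Leibniz rule
`a Dⁱ · b Dʲ = ∑_{k ≥ 0} (i choose k) a (∂ᵏ b) D^{i+j-k}`, `i, j ∈ ℤ`. The sum below has only finitely
many non-zero terms. -/
noncomputable instance : Mul (PDO d) :=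
  ⟨fun A B => mk
    (fun n => ∑ᶠ p : ℤ × ℕ,
      (Ring.choose p.1 p.2 : ℤ) • (A.coeff p.1 * d^[p.2] (B.coeff (n - p.1 + p.2)))) (by
    obtain ⟨M, hM⟩ := A.exists_bound
    obtain ⟨N, hN⟩ := B.exists_bound
    refine ⟨M + N, fun n hn => ?_⟩
    refine finsum_eq_zero_of_forall_eq_zero fun p => ?_
    rcases lt_or_ge M p.1 with h | h
    · rw [hM _ h]; simp
    · rw [hN (n - p.1 + p.2) (by omega), iterate_map_zero]; simp)⟩

noncomputable instance : Pow (PDO d) ℕ := ⟨fun A n => npowRec n A⟩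

/-- The commutator `[A, B] = A B - B A`. -/
noncomputable def comm (A B : PDO d) : PDO d := A * B - B * A

/-- The differential part `A₊`. -/
def plus (A : PDO d) : PDO d :=
  mk (fun n => if 0 ≤ n then A.coeff n else 0) (by
    obtain ⟨N, hN⟩ := A.exists_bound
    exact ⟨N, fun n hn => by simp [hN n hn]⟩)

/-- The purely pseudo-differential part `A₋`. -/
def minus (A : PDO d) : PDO d :=
  mk (fun n => if n < 0 then A.coeff n else 0) ⟨0, fun n hn => if_neg (by omega)⟩

/-- The formal adjoint: `(∑ aₙ Dⁿ)* = ∑ (-D)ⁿ aₙ`, expanded by the Leibniz rule. -/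
noncomputable def adjoint (A : PDO d) : PDO d :=
  mk (fun n => ∑ᶠ k : ℕ,
      ((n + k).negOnePow : ℤ) • (Ring.choose (n + k) k : ℤ) • d^[k] (A.coeff (n + k))) (by
    obtain ⟨N, hN⟩ := A.exists_bound
    refine ⟨N, fun n hn => ?_⟩
    refine finsum_eq_zero_of_forall_eq_zero fun k => ?_
    rw [hN (n + k) (by omega), iterate_map_zero]; simp)

/-- The action `A₊(f) = ∑_{n ≥ 0} aₙ ∂ⁿ f` of the differential part of `A` on a function. -/
noncomputable def plusApply (A : PDO d) (f : R) : R := ∑ᶠ n : ℕ, A.coeff n * d^[n] f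

/-- Differentiation of the coefficients of an operator along `e`. -/
def diff (e : Derivation ℤ R R) (A : PDO d) : PDO d :=
  mk (fun n => e (A.coeff n)) (by
    obtain ⟨N, hN⟩ := A.exists_bound
    exact ⟨N, fun n hn => by simp [hN n hn]⟩)

end PDO

open PDO

/-- `A = D + u₁ D⁻¹ + u₂ D⁻² + …`. -/
def IsLaxForm {d : Derivation ℤ R R} (A : PDO d) : Prop :=
  A.coeff 1 = 1 ∧ A.coeff 0 = 0 ∧ ∀ n : ℤ, 1 < n → A.coeff n = 0

/-- `A = 1 + w₁ D⁻¹ + w₂ D⁻² + …`. -/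
def IsDressingForm {d : Derivation ℤ R R} (A : PDO d) : Prop :=
  A.coeff 0 = 1 ∧ ∀ n : ℤ, 0 < n → A.coeff n = 0

/-! ### Eigenfunctions and ghost generators

In this section `d r`, `r ≥ 1`, are the isospectral times of `L`, with `D` given by `d 1`, and
`e s`, `s ≥ 1`, are the ghost times. -/

/-- `F` is an eigenfunction of `L`: `∂F/∂t_r = (Lʳ)₊(F)`. -/
def IsEigenfunction (d : ℕ → Derivation ℤ R R) (L : PDO (d 1)) (F : R) : Prop :=
  ∀ r, 1 ≤ r → d r F = (L ^ r).plusApply F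

/-- `G` is an adjoint eigenfunction of `L`: `∂G/∂t_r = -((L*)ʳ)₊(G)`. -/
def IsAdjEigenfunction (d : ℕ → Derivation ℤ R R) (L : PDO (d 1)) (G : R) : Prop :=
  ∀ r, 1 ≤ r → d r G = -((L.adjoint ^ r).plusApply G)

/-- The ghost generator `∑_{j=1}^s Φ_{s-j+1} D⁻¹ Ψ_j`. -/
noncomputable def ghostGenerator (d : Derivation ℤ R R) (Φ Ψ : ℕ → R) (s : ℕ) : PDO d :=
  ∑ j ∈ Finset.Icc 1 s, mulOp (Φ (s - j + 1)) * Dinv * mulOp (Ψ j)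

/-- `F` is a generic eigenfunction of `L`, with respect to the ghost flows generated by `(Φ, Ψ)`:
it is an eigenfunction in the times `d`, and in the ghost times `e` it evolves by
`∂F/∂t̄_s = ∑_{j=1}^s Φ_{s-j+1} ∂⁻¹(Ψ_j F)`, where `T j` is the primitive `∂⁻¹(Ψ_j F)`. -/
def IsGenericEigenfunction (d e : ℕ → Derivation ℤ R R) (L : PDO (d 1)) (Φ Ψ : ℕ → R) (F : R) :
    Prop :=
  IsEigenfunction d L F ∧
    ∃ T : ℕ → R, (∀ j, 1 ≤ j → d 1 (T j) = Ψ j * F) ∧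
      ∀ s, 1 ≤ s → e s F = ∑ j ∈ Finset.Icc 1 s, Φ (s - j + 1) * T j

/-! ### Wronskians and the ghost Lax operator -/

/-- The Wronskian `det (∂^{α-1} f_β)`, `α, β = 1, …, k`, of `k` functions. -/
def wronskian (d : Derivation ℤ R R) {k : ℕ} (f : Fin k → R) : R :=
  (Matrix.of fun α β : Fin k => d^[(α : ℕ)] (f β)).det

/-- `W_k[f₁, …, f_k]` for the first `k` members of a sequence; it is `1` for `k = 0`. -/
def wr (d : Derivation ℤ R R) (f : ℕ → R) (k : ℕ) : R :=
  wronskian d fun β : Fin k => f (β + 1)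

/-- `W_{k+1}[f₁, …, f_k, g]`. -/
def wrExt (d : Derivation ℤ R R) (f : ℕ → R) (k : ℕ) (g : R) : R :=
  wronskian d (Fin.snoc (α := fun _ => R) (fun β : Fin k => f (β + 1)) g)

/-- The logarithmic derivative `∂ ln f = (∂f)/f` of an invertible function. -/
noncomputable def dlog (d : Derivation ℤ R R) (f : R) : R := d f * Ring.inverse f

/-- With `𝒲_j` the `d`-Wronskians of `Ψ₁, …, Ψ_j`, and `D̄` the operator of `e`, the product
`(D̄ - ∂̄ ln(𝒲_{j-1}/𝒲_{j-2})) ⋯ (D̄ - ∂̄ ln Ψ₁) (D̄ - ∂̄ ln(1/Φ₁))` of `j` factors. -/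
noncomputable def ghostFactor (d e : Derivation ℤ R R) (Φ Ψ : ℕ → R) : ℕ → PDO e
  | 0 => 1
  | 1 => D - mulOp (dlog e (Ring.inverse (Φ 1)))
  | j + 2 => (D - mulOp (dlog e (wr d Ψ (j + 1) * Ring.inverse (wr d Ψ j)))) *
      ghostFactor d e Φ Ψ (j + 1)

/-- The differential operator `M̄_s` in `D̄ = ∂̄/∂t̄₁`,
`∑_{j=1}^s (∑_{k=j}^s (Φ_{s-k+1}/Φ₁) 𝒲_{j-1}(Ψ_k)/𝒲_j) (D̄ - ∂̄ ln(𝒲_{j-1}/𝒲_{j-2})) ⋯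
(D̄ - ∂̄ ln(1/Φ₁)) - ∂ ln Φ₁/∂t̄_s`. -/
noncomputable def ghostZS (d e : ℕ → Derivation ℤ R R) (Φ Ψ : ℕ → R) (s : ℕ) : PDO (e 1) :=
  ∑ j ∈ Finset.Icc 1 s,
    mulOp (∑ k ∈ Finset.Icc j s, Φ (s - k + 1) * Ring.inverse (Φ 1) *
      (wrExt (d 1) Ψ (j - 1) (Ψ k) * Ring.inverse (wr (d 1) Ψ j))) *
        ghostFactor (d 1) (e 1) Φ Ψ j
  - mulOp (dlog (e s) (Φ 1))

/-- `Lbar` is the ghost Lax operator: `Lbar = D̄ + O(D̄⁻¹)` and `(Lbarˢ)₊ = M̄_s` for `s ≥ 1`. -/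
def IsGhostLax (d e : ℕ → Derivation ℤ R R) (Φ Ψ : ℕ → R) (Lbar : PDO (e 1)) : Prop :=
  IsLaxForm Lbar ∧ ∀ s, 1 ≤ s → (Lbar ^ s).plus = ghostZS d e Φ Ψ s

/-! ### The dual (adjoint) eigenfunctions -/

/-- `P` is a value of the iterated integral `∂⁻¹ h₁ ∂⁻¹ h₂ ⋯ ∂⁻¹ h_n` (and is `1` for `n = 0`). -/
def IsIteratedPrimitive (d : Derivation ℤ R R) : List R → R → Prop
  | [], P => P = 1
  | h :: t, P => ∃ Q, IsIteratedPrimitive d t Q ∧ d P = h * Q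

/-- The integrands `Φ₁Ψ₁, 𝒲₂/Ψ₁², 𝒲₃Ψ₁/𝒲₂², …, 𝒲_i 𝒲_{i-2}/𝒲_{i-1}², …`, numbered from `0`. -/
noncomputable def dualIntegrand (d : Derivation ℤ R R) (Φ Ψ : ℕ → R) : ℕ → R
  | 0 => Φ 1 * Ψ 1
  | i + 1 => wr d Ψ (i + 2) * wr d Ψ i * Ring.inverse (wr d Ψ (i + 1) ^ 2)

/-- The integrands `W₃Φ₁/W₂², …, W_{i+1} W_{i-1}/W_i², …`, numbered from `0`. -/
noncomputable def adjDualIntegrand (d : Derivation ℤ R R) (Φ : ℕ → R) (i : ℕ) : R :=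
  wr d Φ (i + 3) * wr d Φ (i + 1) * Ring.inverse (wr d Φ (i + 2) ^ 2)

/-- `Φ̄₁ = 1/Φ₁`,
`Φ̄_l = (-1)ˡ (1/Φ₁) ∂̄⁻¹ Φ₁Ψ₁ ∂̄⁻¹ (𝒲₂/Ψ₁²) ∂̄⁻¹ ⋯ ∂̄⁻¹ (𝒲_{l-1}𝒲_{l-3}/𝒲_{l-2}²)` for `l ≥ 2`, and
`Ψ̄_j = (-1)^{j-1} (W₂/Φ₁) ∂̄⁻¹ (W₃Φ₁/W₂²) ∂̄⁻¹ ⋯ ∂̄⁻¹ (W_{j+1}W_{j-1}/W_j²)` for `j ≥ 1`. -/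
def IsDualSystem (d e : Derivation ℤ R R) (Φ Ψ Φbar Ψbar : ℕ → R) : Prop :=
  Φbar 1 = Ring.inverse (Φ 1) ∧
  (∀ l, 2 ≤ l → ∃ P, IsIteratedPrimitive e ((List.range (l - 1)).map (dualIntegrand d Φ Ψ)) P ∧
    Φbar l = (-1) ^ l * (Ring.inverse (Φ 1) * P)) ∧
  ∀ j, 1 ≤ j → ∃ P, IsIteratedPrimitive e ((List.range (j - 1)).map (adjDualIntegrand d Φ)) P ∧
    Ψbar j = (-1) ^ (j - 1) * (wr d Φ 2 * Ring.inverse (Φ 1) * P)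

end DoubleKP

/-! The two sets of times play symmetric roles, and the symmetry is visible on dressing operators.
On the ghost side put W̄ = 1 + ∑ (Φ_{l+1}/Φ₁) D̄^{-l} (`ghostDressing`): the Φ_k are for L̄ what the
w_l are for L.

The given primitives S_{kj} of Φ_kΨ_j have no freedom along t̄₁: commutativity of the ghost flows
and independence of the Φ_k over the x-constants force ∂̄S_{kj} = S_{k,j+1} + S_{1j}S_{k1} -
S_{k+1,j} (`db_one_primitive`). So ∂̄ raises an index up to a multiple of the first member.
Eliminating Ψ₁, Ψ₂, … one after the other turns this into the first-order factors of M̄_s, whose sum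
collapses to ∑ (Φ_{s-k+1}/Φ₁) T_k (`sum_ghost_terms`). Applied to operators, this reads M̄_s W̄ =
∂W̄/∂t̄_s + W̄ D̄ˢ, whence L̄ = W̄ D̄ W̄⁻¹ has the required differential parts; `eq_of_plus_pow_eq`
gives uniqueness. Applied to functions, it gives the L̄-eigenfunction equations of F/Φ₁ and of
Φ̄_{l+1} = w_l/Φ₁. The same elimination produces the iterated integrals for Φ̄_l and Ψ̄_j.

In the direction of t_r, write (Lʳ)₊(F) = ∑ w_l Y_{r-l+1}(F), where Y_m(F) is the D⁰ coefficient of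
D^{m-1} W⁻¹ F. Dividing by Φ₁ leaves ∂(F/Φ₁)/∂t_r = ∑ Φ̄_{r-i+1} (Y_{i+1}(F) - (F/Φ₁) Y_{i+1}(Φ₁)).
The bracket is a t̄₁-primitive of Ψ̄_i F/Φ₁, where Ψ̄_i is the bracket for F = Φ₂. For F = Φ_{l+1}
this says ∂W̄/∂t_r = 𝓜̄_r W̄ (`diff_ghostDressing`). The Lax equations follow by dressing, and the
adjoint equations of Ψ̄_i are the residue of the zero curvature equation.

For the converse, the t̄-equations and the equation r = 1 determine the primitives of Ψ_k F for F =
Φ₁F̄. The remaining defect in the t_r-equations is expressed through t̄₁-constants E_i with E₁ = 0,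
and `defect_equation` gives E_{i+1} = ∂E_i, so it vanishes. -/

namespace DoubleKP
open PDO
variable {R : Type*} [CommRing R]

/-! ### The ring of pseudo-differential operators -/

namespace PDO
variable {d : Derivation ℤ R R}

theorem ext_coeff {A B : PDO d} (h : ∀ n, A.coeff n = B.coeff n) : A = B :=
  Subtype.ext (funext h)

@[simp] theorem coeff_mk (a : ℤ → R) (h) (n : ℤ) : (mk a h : PDO d).coeff n = a n := rfl
@[simp] theorem coeff_zero (n : ℤ) : (0 : PDO d).coeff n = 0 := rfl
@[simp] theorem coeff_add (A B : PDO d) (n : ℤ) : (A + B).coeff n = A.coeff n + B.coeff n := rfl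
@[simp] theorem coeff_neg (A : PDO d) (n : ℤ) : (-A).coeff n = -A.coeff n := rfl
@[simp] theorem coeff_sub (A B : PDO d) (n : ℤ) : (A - B).coeff n = A.coeff n - B.coeff n := rfl

/-- The coefficient of `Dⁿ` as an additive map. -/
def coeffHom (n : ℤ) : PDO d →+ R where
  toFun A := A.coeff n
  map_zero' := rfl
  map_add' _ _ := rfl

theorem coeff_sum {ι : Type*} (s : Finset ι) (f : ι → PDO d) (n : ℤ) :
    (∑ i ∈ s, f i).coeff n = ∑ i ∈ s, (f i).coeff n :=
  map_sum (coeffHom n) f s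

theorem coeff_monomial (m : ℤ) (f : R) (n : ℤ) :
    (monomial m f : PDO d).coeff n = if n = m then f else 0 := rfl

theorem coeff_mulOp (f : R) (n : ℤ) : (mulOp f : PDO d).coeff n = if n = 0 then f else 0 := rfl

theorem coeff_one (n : ℤ) : (1 : PDO d).coeff n = if n = 0 then 1 else 0 := rfl

/-- The operator has no terms of order above `N`. -/
def OrderLE (A : PDO d) (N : ℤ) : Prop := ∀ n, N < n → A.coeff n = 0

theorem OrderLE.mono {A : PDO d} {M N : ℤ} (h : A.OrderLE M) (hMN : M ≤ N) : A.OrderLE N :=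
  fun n hn => h n (by omega)

theorem exists_orderLE (A : PDO d) : ∃ N, A.OrderLE N := A.exists_bound

theorem exists_orderLE_ge (A : PDO d) (M : ℤ) : ∃ N, M ≤ N ∧ A.OrderLE N := by
  obtain ⟨N, hN⟩ := A.exists_bound
  exact ⟨max M N, le_max_left _ _, OrderLE.mono hN (le_max_right _ _)⟩

theorem orderLE_monomial (m : ℤ) (f : R) : (monomial m f : PDO d).OrderLE m :=
  fun n hn => by rw [coeff_monomial, if_neg (by omega)]

/-- The coefficient of `Dⁿ` in `Dⁱ B`. -/
noncomputable def powCoeff (i n : ℤ) (B : PDO d) : R :=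
  ∑ᶠ k : ℕ, (Ring.choose i k : ℤ) • d^[k] (B.coeff (n - i + k))

theorem powCoeff_eq_sum (i n : ℤ) {B : PDO d} {N : ℤ} (hB : B.OrderLE N) {K : ℕ}
    (hK : N - n + i < K) :
    powCoeff i n B = ∑ k ∈ Finset.range K, (Ring.choose i k : ℤ) • d^[k] (B.coeff (n - i + k)) := by
  refine finsum_eq_sum_of_support_subset _ fun k hk => ?_
  simp only [Finset.coe_range, Set.mem_Iio]
  by_contra h
  refine hk ?_
  simp only
  rw [hB _ (by omega), iterate_map_zero, smul_zero]

theorem powCoeff_eq_zero (i n : ℤ) {B : PDO d} {N : ℤ} (hB : B.OrderLE N) (h : N + i < n) :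
    powCoeff i n B = 0 := by
  rw [powCoeff_eq_sum i n hB (K := 0) (by omega)]; simp

/-- Turns the `finsum` of the product into an honest finite sum. The lower end `a` is left free, so
that different products can be summed over one common range. -/
theorem coeff_mul_eq_sum {A B : PDO d} {M N a : ℤ} (hA : A.OrderLE M) (hB : B.OrderLE N) (n : ℤ)
    (ha : a ≤ n - N) :
    (A * B).coeff n = ∑ i ∈ Finset.Icc a M, A.coeff i * powCoeff i n B := by
  obtain ⟨K, hK⟩ : ∃ K : ℕ, N - n + M < K := ⟨(N - n + M + 1).toNat, by omega⟩
  have h : (A * B).coeff n = ∑ᶠ p : ℤ × ℕ,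
      (Ring.choose p.1 p.2 : ℤ) • (A.coeff p.1 * d^[p.2] (B.coeff (n - p.1 + p.2))) := rfl
  rw [h, finsum_eq_sum_of_support_subset (s := Finset.Icc a M ×ˢ Finset.range K)]
  · rw [Finset.sum_product]
    refine Finset.sum_congr rfl fun i hi => ?_
    rw [Finset.mem_Icc] at hi
    rw [powCoeff_eq_sum i n hB (K := K) (by omega), Finset.mul_sum]
    exact Finset.sum_congr rfl fun k _ => by rw [mul_smul_comm]
  · rintro ⟨i, k⟩ hp
    simp only [Function.mem_support] at hp
    simp only [Finset.coe_product, Finset.coe_Icc, Finset.coe_range, Set.mem_prod, Set.mem_Icc,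
      Set.mem_Iio]
    have h1 : i ≤ M := by
      by_contra h
      exact hp (by rw [hA _ (by omega)]; simp)
    have h2 : n - i + k ≤ N := by
      by_contra h
      exact hp (by rw [hB _ (by omega), iterate_map_zero]; simp)
    omega

theorem OrderLE.mul {A B : PDO d} {M N : ℤ} (hA : A.OrderLE M) (hB : B.OrderLE N) :
    (A * B).OrderLE (M + N) := fun n hn => by
  rw [coeff_mul_eq_sum hA hB n le_rfl]
  exact Finset.sum_eq_zero fun i hi => by rw [Finset.mem_Icc] at hi; omega

/-- Pascal's rule for `Ring.choose`, valid for negative `i` as well. -/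
theorem powCoeff_succ (i n : ℤ) (B : PDO d) :
    powCoeff (i + 1) n B = d (powCoeff i n B) + powCoeff i (n - 1) B := by
  obtain ⟨N, hB⟩ := B.exists_orderLE
  obtain ⟨K, hK⟩ : ∃ K : ℕ, N - n + i + 1 < K := ⟨(N - n + i + 2).toNat, by omega⟩
  rw [powCoeff_eq_sum (i + 1) n hB (K := K + 1) (by push_cast; omega),
    powCoeff_eq_sum i n hB (K := K) (by omega),
    powCoeff_eq_sum i (n - 1) hB (K := K + 1) (by push_cast; omega), map_sum,
    Finset.sum_range_succ', Finset.sum_range_succ', ← add_assoc, ← Finset.sum_add_distrib]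
  congr 1
  · refine Finset.sum_congr rfl fun k _ => ?_
    have e1 : n - (i + 1) + ((k + 1 : ℕ) : ℤ) = n - i + k := by push_cast; ring
    have e2 : n - 1 - i + ((k + 1 : ℕ) : ℤ) = n - i + k := by push_cast; ring
    rw [Ring.choose_succ_succ, add_smul, map_zsmul, e1, e2, ← Function.iterate_succ_apply' d]
  · simp only [Ring.choose_zero_right, Nat.cast_zero]
    rw [show n - (i + 1) + 0 = n - 1 - i + 0 by omega]

theorem coeff_zpow_mul (i n : ℤ) (f : R) (B : PDO d) :
    (monomial i f * B).coeff n = f * powCoeff i n B := by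
  obtain ⟨N, hB⟩ := B.exists_orderLE
  rw [coeff_mul_eq_sum (orderLE_monomial i f) hB n (a := min i (n - N)) (min_le_right _ _),
    Finset.sum_eq_single i]
  · simp [coeff_monomial]
  · intro j _ hj; simp [coeff_monomial, hj]
  · intro h; exact absurd (Finset.mem_Icc.2 ⟨min_le_left _ _, le_rfl⟩) h

theorem powCoeff_zero (n : ℤ) (B : PDO d) : powCoeff 0 n B = B.coeff n := by
  obtain ⟨N, hB⟩ := B.exists_orderLE
  obtain ⟨K, hK⟩ : ∃ K : ℕ, N - n < K := ⟨(N - n + 1).toNat, by omega⟩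
  rw [powCoeff_eq_sum 0 n hB (K := K + 1) (by push_cast; omega), Finset.sum_range_succ']
  simp [Ring.choose_zero_succ]

theorem powCoeff_one (n : ℤ) (B : PDO d) :
    powCoeff 1 n B = d (B.coeff n) + B.coeff (n - 1) := by
  have := powCoeff_succ 0 n B
  rwa [zero_add, powCoeff_zero, powCoeff_zero] at this

@[simp] theorem coeff_mulOp_mul (f : R) (B : PDO d) (n : ℤ) :
    (mulOp f * B).coeff n = f * B.coeff n := by
  rw [mulOp, coeff_zpow_mul, powCoeff_zero]

theorem coeff_D_mul (B : PDO d) (n : ℤ) : (D * B).coeff n = d (B.coeff n) + B.coeff (n - 1) := by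
  rw [D, coeff_zpow_mul, powCoeff_one, one_mul]

/-- The leading coefficient of D C is that of C, so D C = 0 kills the coefficients of C one by one
from the top. In particular D⁻¹ involves no constants of integration. -/
theorem D_mul_injective {A B : PDO d} (h : D * A = D * B) : A = B := by
  obtain ⟨N, hN⟩ := (A - B).exists_orderLE
  have h0 : ∀ n, d ((A - B).coeff n) + (A - B).coeff (n - 1) = 0 := fun n => by
    have := congrArg (fun C => C.coeff n) h
    simp only [coeff_D_mul] at this
    rw [coeff_sub, coeff_sub, map_sub]
    linear_combination this
  have h1 : ∀ k : ℕ, ∀ n, N - k < n → (A - B).coeff n = 0 := by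
    intro k
    induction k with
    | zero => intro n hn; exact hN n (by simpa using hn)
    | succ k ih =>
      intro n hn
      have h2 := h0 (n + 1)
      rw [ih (n + 1) (by push_cast at hn; omega), map_zero, zero_add, add_sub_cancel_right] at h2
      exact h2
  refine ext_coeff fun n => ?_
  have := h1 (N - n + 1).toNat n (by omega)
  rwa [coeff_sub, sub_eq_zero] at this

theorem mul_add' (A B C : PDO d) : A * (B + C) = A * B + A * C := by
  obtain ⟨M, hA⟩ := A.exists_orderLE
  obtain ⟨N, hB⟩ := B.exists_orderLE
  obtain ⟨N', hNN, hC⟩ := C.exists_orderLE_ge N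
  have hB := hB.mono hNN
  have hBC : (B + C).OrderLE N' := fun n hn => by rw [coeff_add, hB n hn, hC n hn, add_zero]
  refine ext_coeff fun n => ?_
  rw [coeff_add, coeff_mul_eq_sum hA hBC n le_rfl, coeff_mul_eq_sum hA hB n le_rfl,
    coeff_mul_eq_sum hA hC n le_rfl, ← Finset.sum_add_distrib]
  refine Finset.sum_congr rfl fun i _ => ?_
  obtain ⟨K, hK⟩ : ∃ K : ℕ, N' - n + i < K := ⟨(N' - n + i + 1).toNat, by omega⟩
  rw [powCoeff_eq_sum i n hBC hK, powCoeff_eq_sum i n hB hK, powCoeff_eq_sum i n hC hK, ← mul_add,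
    ← Finset.sum_add_distrib]
  congr 1
  exact Finset.sum_congr rfl fun k _ => by rw [coeff_add, iterate_map_add, smul_add]

theorem add_mul' (A B C : PDO d) : (A + B) * C = A * C + B * C := by
  obtain ⟨M, hA⟩ := A.exists_orderLE
  obtain ⟨M', hMM, hB⟩ := B.exists_orderLE_ge M
  obtain ⟨N, hC⟩ := C.exists_orderLE
  have hA := hA.mono hMM
  have hAB : (A + B).OrderLE M' := fun n hn => by rw [coeff_add, hA n hn, hB n hn, add_zero]
  refine ext_coeff fun n => ?_
  rw [coeff_add, coeff_mul_eq_sum hAB hC n le_rfl, coeff_mul_eq_sum hA hC n le_rfl,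
    coeff_mul_eq_sum hB hC n le_rfl, ← Finset.sum_add_distrib]
  exact Finset.sum_congr rfl fun i _ => by rw [coeff_add, add_mul]

theorem one_mul' (A : PDO d) : 1 * A = A :=
  ext_coeff fun n => (coeff_mulOp_mul 1 A n).trans (one_mul _)

theorem D_mul_assoc (A B : PDO d) : D * (A * B) = D * A * B := by
  obtain ⟨M, hA⟩ := A.exists_orderLE
  obtain ⟨N, hB⟩ := B.exists_orderLE
  have hA1 := hA.mono (show M ≤ M + 1 by omega)
  have hDA : (D * A).OrderLE (M + 1) := by
    rw [add_comm]; exact (orderLE_monomial 1 1).mul hA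
  refine ext_coeff fun n => ?_
  rw [coeff_D_mul, coeff_mul_eq_sum hA1 hB n (a := n - 1 - N) (by omega),
    coeff_mul_eq_sum hA hB (n - 1) (a := n - 1 - N) (by omega),
    coeff_mul_eq_sum hDA hB n (a := n - 1 - N) (by omega), map_sum]
  simp only [Derivation.leibniz, smul_eq_mul, coeff_D_mul, add_mul, Finset.sum_add_distrib]
  have e1 : ∑ i ∈ Finset.Icc (n - 1 - N) (M + 1), A.coeff i * d (powCoeff i n B) =
      ∑ i ∈ Finset.Icc (n - 1 - N) M, A.coeff i * d (powCoeff i n B) := by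
    symm
    refine Finset.sum_subset (Finset.Icc_subset_Icc le_rfl (by omega)) fun i hi hi' => ?_
    rw [Finset.mem_Icc] at hi hi'
    rw [hA i (by omega), zero_mul]
  have e2 : ∑ i ∈ Finset.Icc (n - 1 - N) (M + 1), A.coeff (i - 1) * powCoeff i n B =
      ∑ i ∈ Finset.Icc (n - 1 - N) M, A.coeff i * powCoeff (i + 1) n B := by
    have : ∑ i ∈ Finset.Icc (n - 1 - N + 1) (M + 1), A.coeff (i - 1) * powCoeff i n B =
        ∑ i ∈ Finset.Icc (n - 1 - N) M, A.coeff i * powCoeff (i + 1) n B := by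
      rw [← Finset.map_add_right_Icc, Finset.sum_map]
      exact Finset.sum_congr rfl fun i _ => by simp
    rw [← this]
    symm
    refine Finset.sum_subset (Finset.Icc_subset_Icc (by omega) le_rfl) fun i hi hi' => ?_
    rw [Finset.mem_Icc] at hi hi'
    rw [powCoeff_eq_zero i n hB (by omega), mul_zero]
  rw [e1, e2]
  simp only [powCoeff_succ, mul_add, Finset.sum_add_distrib]
  have e3 : ∀ i, powCoeff i n B * d (A.coeff i) = d (A.coeff i) * powCoeff i n B :=
    fun i => mul_comm _ _
  simp only [e3]
  ring

theorem D_mul_zpow_mul (i : ℤ) (B : PDO d) : D * (monomial i 1 * B) = monomial (i + 1) 1 * B :=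
  ext_coeff fun n => by
    simp only [coeff_D_mul, coeff_zpow_mul, powCoeff_succ, one_mul]

/-- Positive powers follow from `D_mul_assoc`; negative ones are reached by cancelling D on the
left. -/
theorem zpow_mul_assoc (i : ℤ) (A B : PDO d) :
    monomial i 1 * (A * B) = monomial i 1 * A * B := by
  induction i using Int.induction_on with
  | zero =>
    change 1 * (A * B) = 1 * A * B
    rw [one_mul', one_mul']
  | succ i ih => rw [← D_mul_zpow_mul, ih, D_mul_assoc, D_mul_zpow_mul]
  | pred i ih =>
    apply D_mul_injective
    rw [D_mul_zpow_mul, D_mul_assoc, D_mul_zpow_mul, sub_add_cancel, ih]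

/-- By linearity in A it is enough to treat A = Dⁱ, which is `zpow_mul_assoc`; the rest is an
exchange of two finite sums. -/
theorem mul_assoc' (A B C : PDO d) : A * B * C = A * (B * C) := by
  obtain ⟨L, hA⟩ := A.exists_orderLE
  obtain ⟨M, hB⟩ := B.exists_orderLE
  obtain ⟨N, hC⟩ := C.exists_orderLE
  refine ext_coeff fun n => ?_
  have h : ∀ i, powCoeff i n (B * C) = ((monomial i 1 * B) * C).coeff n := fun i => by
    rw [← zpow_mul_assoc, coeff_zpow_mul, one_mul]
  rw [coeff_mul_eq_sum hA (hB.mul hC) n le_rfl, coeff_mul_eq_sum (hA.mul hB) hC n le_rfl]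
  have h2 : ∀ i ∈ Finset.Icc (n - (M + N)) L, A.coeff i * powCoeff i n (B * C) =
      ∑ j ∈ Finset.Icc (n - N) (L + M), A.coeff i * (powCoeff i j B * powCoeff j n C) := by
    intro i hi
    rw [Finset.mem_Icc] at hi
    rw [h, coeff_mul_eq_sum (((orderLE_monomial i 1).mul hB).mono (show _ ≤ L + M by omega)) hC n
      le_rfl, Finset.mul_sum]
    exact Finset.sum_congr rfl fun j _ => by rw [coeff_zpow_mul, one_mul]
  rw [Finset.sum_congr rfl h2, Finset.sum_comm]
  refine Finset.sum_congr rfl fun j hj => ?_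
  rw [Finset.mem_Icc] at hj
  rw [coeff_mul_eq_sum hA hB j (a := n - (M + N)) (by omega), Finset.sum_mul]
  exact Finset.sum_congr rfl fun i _ => by rw [mul_assoc]

theorem powCoeff_monomial (i n m : ℤ) (f : R) (K : ℕ) (hK : m - n + i < K) :
    powCoeff i n (monomial m f : PDO d) =
      ∑ k ∈ Finset.range K, if n - i + k = m then (Ring.choose i k : ℤ) • d^[k] f else 0 := by
  rw [powCoeff_eq_sum i n (orderLE_monomial m f) hK]
  refine Finset.sum_congr rfl fun k _ => ?_
  rw [coeff_monomial]
  split_ifs <;> simp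

theorem iterate_derivation_one (k : ℕ) : d^[k + 1] (1 : R) = 0 := by
  rw [Function.iterate_succ_apply, Derivation.map_one_eq_zero, iterate_map_zero]

theorem powCoeff_zpow (i n m : ℤ) :
    powCoeff i n (monomial m 1 : PDO d) = if n = i + m then 1 else 0 := by
  obtain ⟨K, hK⟩ : ∃ K : ℕ, m - n + i < K := ⟨(m - n + i + 1).toNat, by omega⟩
  rw [powCoeff_monomial i n m 1 (K + 1) (by push_cast; omega), Finset.sum_range_succ',
    Finset.sum_eq_zero]
  · simp only [Nat.cast_zero, Ring.choose_zero_right, Function.iterate_zero, id, zero_add, one_smul]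
    exact if_congr (by omega) rfl rfl
  · intro k _
    rw [iterate_derivation_one]; simp

theorem coeff_mul_zpow (A : PDO d) (m n : ℤ) :
    (A * monomial m 1).coeff n = A.coeff (n - m) := by
  obtain ⟨M, hM, hA⟩ := A.exists_orderLE_ge (n - m)
  rw [coeff_mul_eq_sum hA (orderLE_monomial m 1) n le_rfl, Finset.sum_eq_single (n - m)]
  · rw [powCoeff_zpow, if_pos (by omega), mul_one]
  · intro i _ hi
    rw [powCoeff_zpow, if_neg (by omega), mul_zero]
  · intro h; exact absurd (Finset.mem_Icc.2 ⟨le_rfl, hM⟩) h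

theorem mul_one' (A : PDO d) : A * 1 = A :=
  ext_coeff fun n => by
    have := coeff_mul_zpow A 0 n
    rwa [sub_zero] at this

noncomputable instance : Ring (PDO d) where
  __ := (inferInstance : AddCommGroup (PDO d))
  mul_assoc := mul_assoc'
  one_mul := one_mul'
  mul_one := mul_one'
  left_distrib := mul_add'
  right_distrib := add_mul'
  zero_mul A := by
    have := add_mul' 0 0 A
    rw [add_zero] at this
    exact left_eq_add.mp this
  mul_zero A := by
    have := mul_add' A 0 0
    rw [add_zero] at this
    exact left_eq_add.mp this
  npow n A := A ^ n
  npow_zero _ := rfl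
  npow_succ _ _ := rfl

theorem mulOp_mul_mulOp (f g : R) : (mulOp f * mulOp g : PDO d) = mulOp (f * g) :=
  ext_coeff fun n => by rw [coeff_mulOp_mul, coeff_mulOp, coeff_mulOp, mul_ite, mul_zero]

/-- Multiplication operators, as a ring homomorphism. -/
noncomputable def mulOpHom : R →+* PDO d where
  toFun := mulOp
  map_one' := rfl
  map_mul' f g := (mulOp_mul_mulOp f g).symm
  map_zero' := ext_coeff fun n => by rw [coeff_mulOp]; simp
  map_add' f g := ext_coeff fun n => by simp only [coeff_add, coeff_mulOp]; split_ifs <;> simp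

noncomputable instance : Module R (PDO d) := Module.compHom (PDO d) (mulOpHom (d := d))

theorem smul_eq_mulOp_mul (f : R) (A : PDO d) : f • A = mulOp f * A := rfl

@[simp] theorem coeff_smul (f : R) (A : PDO d) (n : ℤ) : (f • A).coeff n = f * A.coeff n :=
  coeff_mulOp_mul f A n

theorem mulOp_add (f g : R) : (mulOp (f + g) : PDO d) = mulOp f + mulOp g := map_add mulOpHom f g
theorem mulOp_neg (f : R) : (mulOp (-f) : PDO d) = -mulOp f := map_neg mulOpHom f
theorem mulOp_zero : (mulOp 0 : PDO d) = 0 := map_zero mulOpHom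
theorem mulOp_one : (mulOp 1 : PDO d) = 1 := rfl

theorem zpow_mul_zpow (m n : ℤ) : (monomial m 1 * monomial n 1 : PDO d) = monomial (m + n) 1 :=
  ext_coeff fun k => by
    rw [coeff_mul_zpow, coeff_monomial, coeff_monomial]
    exact if_congr (by omega) rfl rfl

theorem D_mul_Dinv : (D * Dinv : PDO d) = 1 := zpow_mul_zpow 1 (-1)
theorem Dinv_mul_D : (Dinv * D : PDO d) = 1 := zpow_mul_zpow (-1) 1

theorem D_pow (n : ℕ) : (D ^ n : PDO d) = monomial n 1 := by
  induction n with
  | zero => rfl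
  | succ n ih => rw [pow_succ, ih, D, zpow_mul_zpow, Nat.cast_succ]

theorem monomial_eq (m : ℤ) (f : R) : (monomial m f : PDO d) = mulOp f * monomial m 1 :=
  ext_coeff fun n => by rw [coeff_mulOp_mul, coeff_monomial, coeff_monomial, mul_ite, mul_one,
    mul_zero]

theorem coeff_mul_D (A : PDO d) (n : ℤ) : (A * D).coeff n = A.coeff (n - 1) := coeff_mul_zpow A 1 n

theorem coeff_mul_Dinv (A : PDO d) (n : ℤ) : (A * Dinv).coeff n = A.coeff (n + 1) := by
  rw [Dinv, coeff_mul_zpow, sub_neg_eq_add]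

theorem D_mul_mulOp (f : R) : (D * mulOp f : PDO d) = mulOp f * D + mulOp (d f) :=
  ext_coeff fun n => by
    rw [coeff_D_mul, coeff_add, coeff_mulOp_mul, coeff_mulOp, coeff_mulOp, coeff_mulOp, D,
      coeff_monomial]
    split_ifs <;> first | omega | simp

/-! ### Residues and the action on functions -/

theorem coeff_mul_top {A B : PDO d} {M N : ℤ} (hA : A.OrderLE M) (hB : B.OrderLE N) :
    (A * B).coeff (M + N) = A.coeff M * B.coeff N := by
  obtain ⟨K, hK⟩ : ∃ K : ℕ, N - (M + N) + M < (K + 1 : ℕ) := ⟨0, by push_cast; omega⟩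
  rw [coeff_mul_eq_sum hA hB (M + N) (a := M) (by omega), Finset.Icc_self, Finset.sum_singleton,
    powCoeff_eq_sum M (M + N) hB hK, Finset.sum_range_succ', Finset.sum_eq_zero]
  · simp
  · intro k _
    rw [hB _ (by push_cast; omega), iterate_map_zero, smul_zero]

theorem orderLE_mulOp (f : R) : (mulOp f : PDO d).OrderLE 0 := orderLE_monomial 0 f

theorem powCoeff_mulOp_of_le (i n : ℤ) (f : R) (k : ℕ) (hk : n - i + k = 0) :
    powCoeff i n (mulOp f : PDO d) = (Ring.choose i k : ℤ) • d^[k] f := by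
  obtain ⟨K, hK⟩ : ∃ K : ℕ, 0 - n + i < K ∧ k < K := ⟨k + 1, by push_cast; omega, by omega⟩
  rw [mulOp, powCoeff_monomial i n 0 f K hK.1, Finset.sum_eq_single k]
  · rw [if_pos hk]
  · intro j _ hj; rw [if_neg (by omega)]
  · intro h; exact absurd (Finset.mem_range.2 hK.2) h

/-- `Res(A f) = Res(A) f`. -/
theorem res_mul_mulOp (A : PDO d) (f : R) : (A * mulOp f).coeff (-1) = A.coeff (-1) * f := by
  obtain ⟨M, hM, hA⟩ := A.exists_orderLE_ge (-1)
  rw [coeff_mul_eq_sum hA (orderLE_mulOp f) (-1) le_rfl, Finset.sum_eq_single (-1)]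
  · rw [powCoeff_mulOp_of_le (-1) (-1) f 0 (by simp)]; simp
  · intro i hi h
    rw [Finset.mem_Icc] at hi
    obtain ⟨k, rfl⟩ := Int.eq_ofNat_of_zero_le (show 0 ≤ i by omega)
    rw [powCoeff_mulOp_of_le k (-1) f (k + 1) (by push_cast; omega), Ring.choose_natCast,
      Nat.choose_succ_self]
    simp
  · intro h; exact absurd (Finset.mem_Icc.2 ⟨by omega, hM⟩) h

/-- Dⁿ f contributes ∂ⁿ f to order zero when n ≥ 0 and nothing when n < 0. The action on functions
thereby becomes a coefficient in the ring, where associativity can be used. -/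
theorem plusApply_eq_coeff (A : PDO d) (f : R) : A.plusApply f = (A * mulOp f).coeff 0 := by
  obtain ⟨M, hM, hA⟩ := A.exists_orderLE_ge 0
  obtain ⟨m, rfl⟩ := Int.eq_ofNat_of_zero_le hM
  have h : ∀ i : ℕ, powCoeff i 0 (mulOp f : PDO d) = d^[i] f := fun i => by
    rw [powCoeff_mulOp_of_le i 0 f i (by simp), Ring.choose_natCast, Nat.choose_self]; simp
  rw [plusApply, coeff_mul_eq_sum hA (orderLE_mulOp f) 0 le_rfl,
    finsum_eq_sum_of_support_subset (s := Finset.range (m + 1))]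
  · refine Finset.sum_bij (fun i _ => (i : ℤ)) ?_ ?_ ?_ ?_
    · intro i hi; rw [Finset.mem_range] at hi; rw [Finset.mem_Icc]; omega
    · intro i _ j _ hij; exact_mod_cast hij
    · intro i hi
      rw [Finset.mem_Icc] at hi
      exact ⟨i.toNat, Finset.mem_range.2 (by omega), by omega⟩
    · intro i _; rw [h]
  · intro i hi
    simp only [Finset.coe_range, Set.mem_Iio]
    by_contra hc
    exact hi (by simp only; rw [hA _ (by omega), zero_mul])

theorem plusApply_plus (A : PDO d) (f : R) : A.plus.plusApply f = A.plusApply f :=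
  finsum_congr fun n => by simp [plus]

theorem plusApply_sub (A B : PDO d) (f : R) :
    (A - B).plusApply f = A.plusApply f - B.plusApply f := by
  simp only [plusApply_eq_coeff, sub_mul, coeff_sub]

theorem plusApply_mulOp_mul (g : R) (A : PDO d) (f : R) :
    (mulOp g * A).plusApply f = g * A.plusApply f := by
  simp only [plusApply_eq_coeff, mul_assoc, coeff_mulOp_mul]

theorem plusApply_mulOp (g f : R) : (mulOp g : PDO d).plusApply f = g * f := by
  rw [plusApply_eq_coeff, mulOp_mul_mulOp, coeff_mulOp, if_pos rfl]

theorem plusApply_sum {ι : Type*} (s : Finset ι) (A : ι → PDO d) (f : R) :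
    (∑ i ∈ s, A i).plusApply f = ∑ i ∈ s, (A i).plusApply f := by
  simp only [plusApply_eq_coeff, Finset.sum_mul, coeff_sum]

/-- The operator has no terms of negative order. -/
def IsDifferential (A : PDO d) : Prop := ∀ n, n < 0 → A.coeff n = 0

theorem IsDifferential.res_mul_mulOp {A : PDO d} (hA : A.IsDifferential) (f : R) :
    (A * mulOp f).coeff (-1) = 0 := by
  rw [PDO.res_mul_mulOp, hA _ (by omega), zero_mul]

theorem IsDifferential.mulOp_mul {A : PDO d} (hA : A.IsDifferential) (f : R) :
    (mulOp f * A).IsDifferential := fun n hn => by rw [coeff_mulOp_mul, hA n hn, mul_zero]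

theorem IsDifferential.D_mul {A : PDO d} (hA : A.IsDifferential) :
    (D * A).IsDifferential := fun n hn => by
  rw [coeff_D_mul, hA n hn, hA (n - 1) (by omega), map_zero, add_zero]

theorem IsDifferential.sub {A B : PDO d} (hA : A.IsDifferential) (hB : B.IsDifferential) :
    (A - B).IsDifferential := fun n hn => by rw [coeff_sub, hA n hn, hB n hn, sub_zero]

theorem isDifferential_mulOp (f : R) : (mulOp f : PDO d).IsDifferential :=
  fun n hn => by rw [coeff_mulOp, if_neg (by omega)]

theorem isDifferential_sum {ι : Type*} (s : Finset ι) (A : ι → PDO d)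
    (h : ∀ i ∈ s, (A i).IsDifferential) : (∑ i ∈ s, A i).IsDifferential := fun n hn => by
  rw [coeff_sum]
  exact Finset.sum_eq_zero fun i hi => h i hi n hn

theorem plusApply_D_mul {A : PDO d} (hA : A.IsDifferential) (f : R) :
    (D * A).plusApply f = d (A.plusApply f) := by
  rw [plusApply_eq_coeff, plusApply_eq_coeff, mul_assoc, coeff_D_mul, zero_sub,
    hA.res_mul_mulOp, add_zero]

theorem plus_add_minus (A : PDO d) : A.plus + A.minus = A := ext_coeff fun n => by
  simp only [plus, minus, coeff_add, coeff_mk]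
  split_ifs <;> first | omega | simp

theorem plus_eq_of_add {A B C : PDO d} (h : A = B + C) (hB : B.IsDifferential)
    (hC : C.OrderLE (-1)) : A.plus = B := ext_coeff fun n => by
  simp only [plus, coeff_mk, h, coeff_add]
  split_ifs with hn
  · rw [hC n (by omega), add_zero]
  · rw [hB n (by omega)]

theorem orderLE_minus (A : PDO d) : A.minus.OrderLE (-1) :=
  fun _ hn => if_neg (by omega)

/-! ### The formal adjoint -/

/-- The sign in the adjoint is absorbed by reflecting the binomial coefficient, `Ring.choose_neg`.
Written as residues, the coefficients of A* inherit the rules for products from `res_mul_mulOp`. -/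
theorem coeff_adjoint (A : PDO d) (n : ℤ) :
    A.adjoint.coeff n = (n.negOnePow : ℤ) • (monomial (-n - 1) 1 * A).coeff (-1) := by
  obtain ⟨N, hA⟩ := A.exists_orderLE
  obtain ⟨K, hK⟩ : ∃ K : ℕ, N - n < K := ⟨(N - n + 1).toNat, by omega⟩
  rw [coeff_zpow_mul, one_mul, powCoeff_eq_sum _ _ hA (K := K) (by omega), Finset.smul_sum, adjoint,
    coeff_mk, finsum_eq_sum_of_support_subset (s := Finset.range K)]
  · refine Finset.sum_congr rfl fun k _ => ?_
    rw [show -1 - (-n - 1) + (k : ℤ) = n + k by ring, show -n - 1 = -(n + 1) by ring,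
      Ring.choose_neg, show n + 1 + (k : ℤ) - 1 = n + k by ring, Int.negOnePow_add, Units.smul_def]
    simp only [Units.val_mul, smul_smul, smul_eq_mul, mul_assoc]
  · intro k hk
    simp only [Finset.coe_range, Set.mem_Iio]
    by_contra hc
    exact hk (by simp only; rw [hA _ (by omega), iterate_map_zero]; simp)

theorem adjoint_add (A B : PDO d) : (A + B).adjoint = A.adjoint + B.adjoint :=
  ext_coeff fun n => by simp only [coeff_add, coeff_adjoint, mul_add, smul_add]

theorem OrderLE.adjoint {A : PDO d} {N : ℤ} (hA : A.OrderLE N) : A.adjoint.OrderLE N :=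
  fun n hn => by
    rw [coeff_adjoint, ((orderLE_monomial (-n - 1) 1).mul hA) _ (by omega), smul_zero]

theorem adjoint_mul_mulOp (A : PDO d) (b : R) : (A * mulOp b).adjoint = mulOp b * A.adjoint :=
  ext_coeff fun n => by
    rw [coeff_mulOp_mul, coeff_adjoint, coeff_adjoint, ← mul_assoc, res_mul_mulOp, mul_smul_comm,
      mul_comm b]

theorem adjoint_mul_D (A : PDO d) : (A * D).adjoint = -(D * A.adjoint) :=
  ext_coeff fun n => by
    have h : (monomial (-(n - 1) - 1) 1 * A) = D * (monomial (-n - 1) 1 * A) := by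
      rw [D_mul_zpow_mul]; congr 2; ring
    rw [coeff_neg, coeff_D_mul, coeff_adjoint, coeff_adjoint, coeff_adjoint, ← mul_assoc,
      coeff_mul_D, h, coeff_D_mul, Int.negOnePow_sub, Int.negOnePow_one, map_zsmul]
    simp

theorem adjoint_mul_Dinv (A : PDO d) : (A * Dinv).adjoint = -(Dinv * A.adjoint) := by
  have h := adjoint_mul_D (A * Dinv)
  rw [mul_assoc, Dinv_mul_D, mul_one] at h
  rw [h, mul_neg, neg_neg, ← mul_assoc, Dinv_mul_D, one_mul]

theorem adjoint_mul_zpow (A : PDO d) (m : ℤ) :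
    (A * monomial m 1).adjoint = (m.negOnePow : ℤ) • (monomial m 1 * A.adjoint) := by
  induction m using Int.induction_on with
  | zero =>
    change (A * 1).adjoint = ((0 : ℤ).negOnePow : ℤ) • (1 * A.adjoint)
    simp
  | succ m ih =>
    have h : (monomial (m + 1 : ℤ) 1 : PDO d) = monomial m 1 * D := (zpow_mul_zpow _ _).symm
    have h' : (monomial (m + 1 : ℤ) 1 : PDO d) = D * monomial m 1 := by
      rw [D, zpow_mul_zpow, add_comm]
    rw [h, ← mul_assoc, adjoint_mul_D, ih, ← h, h', Int.negOnePow_succ, mul_smul_comm, mul_assoc]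
    simp
  | pred m ih =>
    have h : (monomial (-m - 1 : ℤ) 1 : PDO d) = monomial (-m) 1 * Dinv := (zpow_mul_zpow _ _).symm
    have h' : (monomial (-m - 1 : ℤ) 1 : PDO d) = Dinv * monomial (-m) 1 := by
      rw [Dinv, zpow_mul_zpow]; congr 1; ring
    rw [h, ← mul_assoc, adjoint_mul_Dinv, ih, ← h, h', Int.negOnePow_sub, Int.negOnePow_one,
      mul_smul_comm, mul_assoc]
    simp

theorem adjoint_one : (1 : PDO d).adjoint = 1 := ext_coeff fun n => by
  rw [coeff_adjoint, mul_one, coeff_monomial, coeff_one]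
  split_ifs with h1 h2 h2 <;> first | omega | simp_all

theorem adjoint_monomial (m : ℤ) (b : R) :
    (monomial m b : PDO d).adjoint = (m.negOnePow : ℤ) • (monomial m 1 * mulOp b) := by
  have h : (mulOp b : PDO d).adjoint = mulOp b := by
    have := adjoint_mul_mulOp (1 : PDO d) b
    rwa [one_mul, adjoint_one, mul_one] at this
  rw [monomial_eq, adjoint_mul_zpow, h]

/-- `(A B)* = B* A*`. -/
theorem adjoint_mul (A B : PDO d) : (A * B).adjoint = B.adjoint * A.adjoint := by
  refine ext_coeff fun n => ?_
  obtain ⟨M, hA⟩ := A.exists_orderLE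
  obtain ⟨N, hB⟩ := B.exists_orderLE
  -- Terms of B of order below n - M cannot reach order n, so it suffices to strip finitely many
  -- leading monomials from B.
  have key : ∀ k : ℕ, ∀ B : PDO d, B.OrderLE (n - M - 1 + k) →
      (A * B).adjoint.coeff n = (B.adjoint * A.adjoint).coeff n := by
    intro k
    induction k with
    | zero =>
      intro B hB
      rw [(hA.mul hB).adjoint n (by push_cast; omega),
        (hB.adjoint.mul hA.adjoint) n (by push_cast; omega)]
    | succ k ih =>
      intro B hB
      set m : ℤ := n - M - 1 + (k + 1 : ℕ)
      obtain ⟨B', hB', hBB⟩ : ∃ B' : PDO d, B'.OrderLE (n - M - 1 + k) ∧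
          B = B' + monomial m (B.coeff m) := by
        refine ⟨B - monomial m (B.coeff m), fun i hi => ?_, by abel⟩
        rw [coeff_sub, coeff_monomial]
        split_ifs with h
        · rw [h, sub_self]
        · rw [hB i (by omega), sub_zero]
      have hm : (A * monomial m (B.coeff m)).adjoint =
          (monomial m (B.coeff m)).adjoint * A.adjoint := by
        rw [adjoint_monomial, monomial_eq, ← mul_assoc, adjoint_mul_zpow, adjoint_mul_mulOp,
          smul_mul_assoc, mul_assoc]
      rw [hBB, mul_add, adjoint_add, adjoint_add, add_mul, coeff_add, coeff_add, ih B' hB', hm]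
  exact key (N - n + M + 1).toNat B (hB.mono (by omega))

theorem adjoint_pow (A : PDO d) (n : ℕ) : (A ^ n).adjoint = A.adjoint ^ n := by
  induction n with
  | zero => simp [adjoint_one]
  | succ n ih => rw [pow_succ, adjoint_mul, ih, pow_succ']

/-- `(A*)₊(f) = Res(D⁻¹ f A)`. -/
theorem plusApply_adjoint (A : PDO d) (f : R) :
    A.adjoint.plusApply f = (Dinv * mulOp f * A).coeff (-1) := by
  have h : (mulOp f : PDO d).adjoint = mulOp f := by
    have := adjoint_mul_mulOp (1 : PDO d) f
    rwa [one_mul, adjoint_one, mul_one] at this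
  rw [plusApply_eq_coeff, ← h, ← adjoint_mul, h, coeff_adjoint, mul_assoc]
  simp [Dinv]

theorem plusApply_adjoint_pow (A : PDO d) (n : ℕ) (f : R) :
    (A.adjoint ^ n).plusApply f = (Dinv * mulOp f * A ^ n).coeff (-1) := by
  rw [← adjoint_pow, plusApply_adjoint]

/-! ### Differentiation of coefficients -/

section diff
variable {e : Derivation ℤ R R}

@[simp] theorem coeff_diff (A : PDO d) (n : ℤ) : (A.diff e).coeff n = e (A.coeff n) := rfl

theorem diff_mulOp (f : R) : (mulOp f : PDO d).diff e = mulOp (e f) := ext_coeff fun n => by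
  rw [coeff_diff, coeff_mulOp, coeff_mulOp]; split_ifs <;> simp

theorem diff_zpow (m : ℤ) : (monomial m 1 : PDO d).diff e = 0 := ext_coeff fun n => by
  rw [coeff_diff, coeff_monomial]; split_ifs <;> simp

theorem diff_sub (A B : PDO d) : (A - B).diff e = A.diff e - B.diff e :=
  ext_coeff fun _ => map_sub e _ _

theorem OrderLE.diff {A : PDO d} {N : ℤ} (hA : A.OrderLE N) : (A.diff e).OrderLE N :=
  fun n hn => by rw [coeff_diff, hA n hn, map_zero]

theorem diff_mul (hde : ∀ f, e (d f) = d (e f)) (A B : PDO d) :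
    (A * B).diff e = A.diff e * B + A * B.diff e := by
  have hit : ∀ k f, e (d^[k] f) = d^[k] (e f) := fun k => by
    induction k with
    | zero => intro f; rfl
    | succ k ih => intro f; rw [Function.iterate_succ_apply, ih, hde]; rfl
  obtain ⟨M, hA⟩ := A.exists_orderLE
  obtain ⟨N, hB⟩ := B.exists_orderLE
  have hp : ∀ i n, e (powCoeff i n B) = powCoeff i n (B.diff e) := fun i n => by
    obtain ⟨K, hK⟩ : ∃ K : ℕ, N - n + i < K := ⟨(N - n + i + 1).toNat, by omega⟩
    rw [powCoeff_eq_sum i n hB hK, powCoeff_eq_sum i n hB.diff hK, map_sum]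
    exact Finset.sum_congr rfl fun k _ => by rw [map_zsmul, hit, coeff_diff]
  refine ext_coeff fun n => ?_
  rw [coeff_diff, coeff_add, coeff_mul_eq_sum hA hB n le_rfl,
    coeff_mul_eq_sum hA.diff hB n le_rfl, coeff_mul_eq_sum hA hB.diff n le_rfl, map_sum,
    ← Finset.sum_add_distrib]
  refine Finset.sum_congr rfl fun i _ => ?_
  rw [Derivation.leibniz, hp, smul_eq_mul, smul_eq_mul, coeff_diff]
  ring

theorem diff_one : (1 : PDO d).diff e = 0 := diff_zpow 0

end diff

/-! ### Dressing operators -/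

theorem _root_.DoubleKP.IsDressingForm.orderLE {W : PDO d} (hW : IsDressingForm W) : W.OrderLE 0 := hW.2

/-- The coefficients of the left inverse of a dressing operator. -/
noncomputable def invCoeff (W : PDO d) : ℕ → R
  | 0 => 1
  | n + 1 => -∑ i : Fin (n + 1), invCoeff W i * powCoeff (-(i : ℤ)) (-((n + 1 : ℕ) : ℤ)) W

theorem exists_left_inverse {W : PDO d} (hW : IsDressingForm W) :
    ∃ V : PDO d, IsDressingForm V ∧ V * W = 1 := by
  refine ⟨mk (fun n => if 0 < n then 0 else invCoeff W (-n).toNat)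
    ⟨0, fun n hn => if_pos hn⟩, ⟨by simp [invCoeff], fun n hn => if_pos hn⟩, ?_⟩
  set V : PDO d := mk (fun n => if 0 < n then 0 else invCoeff W (-n).toNat) ⟨0, fun n hn => if_pos hn⟩
  have hV : V.OrderLE 0 := fun n hn => if_pos hn
  have hVn : ∀ n : ℕ, V.coeff (-n) = invCoeff W n := fun n => by simp [V]
  have hdiag : ∀ n : ℤ, powCoeff n n W = 1 := fun n => by
    rw [powCoeff_eq_sum n n hW.orderLE (K := (0 - n + n + 1 : ℤ).toNat) (by omega)]
    simp [hW.1]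
  refine ext_coeff fun n => ?_
  rcases lt_or_ge 0 n with hn | hn
  · rw [(hV.mul hW.orderLE) n (by omega), coeff_one, if_neg (by omega)]
  obtain ⟨m, rfl⟩ : ∃ m : ℕ, n = -m := ⟨(-n).toNat, by omega⟩
  have hsum : (V * W).coeff (-m) =
      ∑ i ∈ Finset.range (m + 1), invCoeff W i * powCoeff (-(i : ℤ)) (-m) W := by
    rw [coeff_mul_eq_sum hV hW.orderLE (-m) (a := -m) (by omega)]
    symm
    refine Finset.sum_bij (fun i _ => -(i : ℤ)) ?_ ?_ ?_ ?_
    · intro i hi; rw [Finset.mem_range] at hi; rw [Finset.mem_Icc]; omega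
    · intro i _ j _ hij; simpa using hij
    · intro i hi
      rw [Finset.mem_Icc] at hi
      exact ⟨(-i).toNat, Finset.mem_range.2 (by omega), by omega⟩
    · intro i _; rw [hVn]
  rw [hsum, Finset.sum_range_succ, hdiag, coeff_one]
  cases m with
  | zero => simp [invCoeff]
  | succ m =>
    rw [if_neg (by push_cast; omega), invCoeff, ← Fin.sum_univ_eq_sum_range
      (fun i => invCoeff W i * powCoeff (-(i : ℤ)) (-((m + 1 : ℕ) : ℤ)) W)]
    simp

/-- A left inverse is again a dressing operator, so it has a left inverse itself, which must be W.
-/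
theorem exists_inverse {W : PDO d} (hW : IsDressingForm W) :
    ∃ V : PDO d, IsDressingForm V ∧ W * V = 1 ∧ V * W = 1 := by
  obtain ⟨V, hV, hVW⟩ := exists_left_inverse hW
  obtain ⟨U, -, hUV⟩ := exists_left_inverse hV
  have : U = W := by rw [← mul_one U, ← hVW, ← mul_assoc, hUV, one_mul]
  exact ⟨V, hV, this ▸ hUV, hVW⟩

theorem isLaxForm_of_dressing {W V : PDO d} (hW : IsDressingForm W) (hV : IsDressingForm V)
    (hVW : V * W = 1) : IsLaxForm (W * D * V) := by
  have hWD : (W * D).OrderLE 1 := by simpa [D] using hW.orderLE.mul (orderLE_monomial 1 1)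
  have h : (W * D * V).OrderLE 1 := by simpa using hWD.mul hV.orderLE
  have h1 : (W * D * V).coeff 1 = 1 := by
    have := coeff_mul_top hWD hV.orderLE
    rw [add_zero] at this
    rw [this, coeff_mul_D, hV.1, sub_self, hW.1, one_mul]
  refine ⟨h1, ?_, h⟩
  -- The D⁰ coefficient is read off from L W = W D: the term w₁ occurs on both sides and cancels.
  have h2 : (W * D * V * W).coeff 0 = (W * D).coeff 0 := by rw [mul_assoc, hVW, mul_one]
  rw [coeff_mul_eq_sum h hW.orderLE 0 (a := 0) (by omega), coeff_mul_D,
    show Finset.Icc (0 : ℤ) 1 = {0, 1} by rfl, Finset.sum_pair (by decide), h1, powCoeff_zero,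
    powCoeff_one, hW.1] at h2
  simpa using h2

/-! ### Uniqueness of an operator with given differential parts of its powers -/

theorem _root_.DoubleKP.IsLaxForm.orderLE {A : PDO d} (hA : IsLaxForm A) : A.OrderLE 1 := hA.2.2

theorem orderLE_pow {A : PDO d} (hA : IsLaxForm A) (s : ℕ) :
    (A ^ s).OrderLE s ∧ (A ^ s).coeff s = 1 := by
  induction s with
  | zero => exact ⟨orderLE_mulOp (1 : R), by simp [coeff_one]⟩
  | succ s ih =>
    rw [pow_succ, Nat.cast_succ]
    exact ⟨ih.1.mul hA.orderLE, by rw [coeff_mul_top ih.1 hA.orderLE, ih.2, hA.1, one_mul]⟩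

/-- Telescoping: each of the `s` terms Aⁱ (A - B) B^{s-1-i} has the leading coefficient of A - B,
because A and B are monic. -/
theorem orderLE_pow_sub_pow {A B : PDO d} (hA : IsLaxForm A) (hB : IsLaxForm B) {m : ℤ}
    (h : (A - B).OrderLE m) (s : ℕ) :
    (A ^ s - B ^ s).OrderLE (s - 1 + m) ∧
      (A ^ s - B ^ s).coeff (s - 1 + m) = s * (A - B).coeff m := by
  induction s with
  | zero => simp [OrderLE]
  | succ s ih =>
    have e : A ^ (s + 1) - B ^ (s + 1) = A ^ s * (A - B) + (A ^ s - B ^ s) * B := by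
      rw [pow_succ, pow_succ]; noncomm_ring
    have h1 := (orderLE_pow hA s).1.mul h
    have h2 := ih.1.mul hB.orderLE
    have c1 := coeff_mul_top (orderLE_pow hA s).1 h
    have c2 := coeff_mul_top ih.1 hB.orderLE
    rw [show (s : ℤ) - 1 + m + 1 = s + m by ring] at h2 c2
    rw [show ((s + 1 : ℕ) : ℤ) - 1 + m = s + m by push_cast; ring, e]
    refine ⟨fun n hn => by rw [coeff_add, h1 n hn, h2 n hn, add_zero], ?_⟩
    rw [coeff_add, c1, c2, (orderLE_pow hA s).2, ih.2, hB.1]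
    push_cast; ring

/-- If A - B has order at most -m, then A^{m+1} - B^{m+1} has order at most 0, and its D⁰
coefficient is (m+1) times the leading coefficient of A - B. Equality of differential parts makes it
zero, and division by m+1 lowers the order of A - B. -/
theorem eq_of_plus_pow_eq [Algebra ℚ R] {A B : PDO d} (hA : IsLaxForm A) (hB : IsLaxForm B)
    (h : ∀ s, 1 ≤ s → (A ^ s).plus = (B ^ s).plus) : A = B := by
  have key : ∀ m : ℕ, (A - B).OrderLE (-m) := by
    intro m
    induction m with
    | zero =>
      intro n hn
      rw [coeff_sub]
      rcases eq_or_lt_of_le (show 1 ≤ n by simp at hn; omega) with h1 | h1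
      · rw [← h1, hA.1, hB.1, sub_self]
      · rw [hA.2.2 n h1, hB.2.2 n h1, sub_self]
    | succ m ih =>
      intro n hn
      rcases eq_or_lt_of_le (show -(m : ℤ) ≤ n by push_cast at hn; omega) with h1 | h1
      · have h2 := (orderLE_pow_sub_pow hA hB ih (m + 1)).2
        rw [show ((m + 1 : ℕ) : ℤ) - 1 + -m = 0 by push_cast; ring, coeff_sub] at h2
        have h3 := congrArg (fun C => C.coeff 0) (h (m + 1) (by omega))
        simp only [plus, coeff_mk, le_refl, if_true] at h3
        rw [h3, sub_self] at h2
        have hu : IsUnit ((m + 1 : ℕ) : R) := by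
          have : IsUnit ((m + 1 : ℕ) : ℚ) := IsUnit.mk0 _ (by positivity)
          simpa using this.map (algebraMap ℚ R)
        rw [← h1]
        exact (hu.mul_right_eq_zero).1 h2.symm
      · exact ih n h1
  refine ext_coeff fun n => ?_
  have := key (-n + 1).toNat n (by omega)
  rwa [coeff_sub, sub_eq_zero] at this

/-- `∂W = X W` and `L W = W D` imply `∂L = [X, L]`. -/
theorem diff_lax {e : Derivation ℤ R R} (hde : ∀ f, e (d f) = d (e f)) {W V L X : PDO d}
    (hWV : W * V = 1) (hL : L * W = W * D) (hX : W.diff e = X * W) : L.diff e = comm X L := by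
  have h := congrArg (diff e) hL
  rw [diff_mul hde, diff_mul hde, hX, D, diff_zpow, mul_zero, add_zero, ← D, mul_assoc X, ← hL] at h
  have h2 : L.diff e * W = comm X L * W := by
    rw [comm, sub_mul, mul_assoc X, ← h, mul_assoc]; abel
  calc L.diff e = L.diff e * W * V := by rw [mul_assoc, hWV, mul_one]
    _ = comm X L := by rw [h2, mul_assoc, hWV, mul_one]

theorem pow_mul_dressing {W L : PDO d} (hL : L * W = W * D) (r : ℕ) : L ^ r * W = W * D ^ r := by
  induction r with
  | zero => simp
  | succ r ih => rw [pow_succ, mul_assoc, hL, ← mul_assoc, ih, mul_assoc, ← pow_succ]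

end PDO

theorem sum_Icc_one {M : Type*} [AddCommMonoid M] (f : ℕ → M) (n : ℕ) :
    ∑ i ∈ Finset.Icc 1 n, f i = ∑ i ∈ Finset.range n, f (i + 1) := by
  induction n with
  | zero => simp
  | succ n ih => rw [Finset.sum_Icc_succ_top (by omega), ih, Finset.sum_range_succ]

theorem derivation_inverse (e : Derivation ℤ R R) {f : R} (hf : IsUnit f) :
    e (Ring.inverse f) = -(Ring.inverse f ^ 2 * e f) := by
  have h := congrArg e (Ring.mul_inverse_cancel f hf)
  rw [Derivation.leibniz, Derivation.map_one_eq_zero, smul_eq_mul, smul_eq_mul] at h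
  linear_combination Ring.inverse f * h - e (Ring.inverse f) * Ring.mul_inverse_cancel f hf

/-! ### Wronskians -/

section wronskian
variable (d : Derivation ℤ R R) (f : ℕ → R)

theorem wr_zero : wr d f 0 = 1 := Matrix.det_isEmpty

theorem wr_one : wr d f 1 = f 1 := by simp [wr, wronskian]

theorem wrExt_self (k : ℕ) : wrExt d f k (f (k + 1)) = wr d f (k + 1) := by
  rw [wrExt, wr]
  congr 1
  funext β
  refine Fin.lastCases ?_ (fun i => ?_) β <;> simp

theorem wrExt_eq_zero {k i : ℕ} (hi : i < k) : wrExt d f k (f (i + 1)) = 0 := by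
  refine Matrix.det_zero_of_column_eq (i := Fin.castSucc ⟨i, hi⟩) (j := Fin.last k)
    (Fin.castSucc_lt_last _).ne fun α => ?_
  simp only [Matrix.of_apply, Fin.snoc_castSucc, Fin.snoc_last]

/-- Laplace expansion along the last column: as a function of g, the extended Wronskian is a
differential operator of order k whose leading coefficient is W_k. -/
theorem exists_wrExt_eq_sum (k : ℕ) : ∃ c : ℕ → R, c k = wr d f k ∧
    ∀ g, wrExt d f k g = ∑ m ∈ Finset.range (k + 1), c m * d^[m] g := by
  refine ⟨fun m => if h : m < k + 1 then (-1) ^ (m + k) * (Matrix.of fun α β : Fin k =>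
    d^[((⟨m, h⟩ : Fin (k + 1)).succAbove α : ℕ)] (f (β + 1))).det else 0, ?_, fun g => ?_⟩
  · simp only [Nat.lt_succ_self, dite_true]
    rw [Even.neg_one_pow ⟨k, rfl⟩, one_mul, wr, wronskian]
    congr 1
    ext α β
    have : (⟨k, Nat.lt_succ_self k⟩ : Fin (k + 1)) = Fin.last k := rfl
    simp [this]
  · rw [wrExt, wronskian, Matrix.det_succ_column _ (Fin.last k), ← Fin.sum_univ_eq_sum_range]
    refine Finset.sum_congr rfl fun i _ => ?_
    have : (Matrix.of fun α β : Fin (k + 1) => d^[(α : ℕ)]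
        (Fin.snoc (α := fun _ => R) (fun β : Fin k => f (β + 1)) g β)).submatrix i.succAbove
        (Fin.last k).succAbove =
        Matrix.of fun α β : Fin k => d^[(i.succAbove α : ℕ)] (f (β + 1)) := by
      ext α β
      simp
    rw [this]
    simp only [i.2, dite_true, Matrix.of_apply, Fin.snoc_last, Fin.val_last]
    ring

variable {d f}

theorem eq_zero_of_sum_mul_iterate {k : ℕ} (hk : IsUnit (wr d f k)) {c : ℕ → R}
    (hc : ∀ i < k, ∑ m ∈ Finset.range k, c m * d^[m] (f (i + 1)) = 0) : ∀ m < k, c m = 0 := by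
  set M : Matrix (Fin k) (Fin k) R := Matrix.of fun α β : Fin k => d^[(α : ℕ)] (f (β + 1))
  have hM : IsUnit M.det := hk
  have h : Matrix.vecMul (fun m : Fin k => c m) M = 0 := by
    funext i
    have := hc i i.2
    rw [← Fin.sum_univ_eq_sum_range (fun m => c m * d^[m] (f (i + 1)))] at this
    simpa [Matrix.vecMul, dotProduct, M] using this
  have h2 := congrArg (fun v => Matrix.vecMul v M⁻¹) h
  simp only [Matrix.vecMul_vecMul, Matrix.mul_nonsing_inv _ hM, Matrix.vecMul_one,
    Matrix.zero_vecMul] at h2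
  exact fun m hm => congrFun h2 ⟨m, hm⟩

/-- Functions with invertible Wronskian are linearly independent over the constants. -/
theorem eq_zero_of_sum_mul_const {k : ℕ} (hk : IsUnit (wr d f k)) {c : ℕ → R}
    (hdc : ∀ i < k, d (c i) = 0) (hc : ∑ i ∈ Finset.range k, f (i + 1) * c i = 0) :
    ∀ i < k, c i = 0 := by
  set M : Matrix (Fin k) (Fin k) R := Matrix.of fun α β : Fin k => d^[(α : ℕ)] (f (β + 1))
  have hM : IsUnit M.det := hk
  have hit : ∀ m, ∑ i ∈ Finset.range k, d^[m] (f (i + 1)) * c i = 0 := by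
    intro m
    induction m with
    | zero => exact hc
    | succ m ih =>
      have := congrArg d ih
      rw [map_sum, map_zero] at this
      rw [← this]
      refine Finset.sum_congr rfl fun i hi => ?_
      rw [Derivation.leibniz, hdc i (Finset.mem_range.1 hi), Function.iterate_succ_apply']
      simp [mul_comm]
  have h : Matrix.mulVec M (fun m : Fin k => c m) = 0 := by
    funext α
    have := hit α
    rw [← Fin.sum_univ_eq_sum_range (fun m => d^[α] (f (m + 1)) * c m)] at this
    simpa [Matrix.mulVec, dotProduct, M] using this
  have h2 := congrArg (fun v => Matrix.mulVec M⁻¹ v) h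
  simp only [Matrix.mulVec_mulVec, Matrix.nonsing_inv_mul _ hM, Matrix.one_mulVec,
    Matrix.mulVec_zero] at h2
  exact fun m hm => congrFun h2 ⟨m, hm⟩

theorem isUnit_wr (hu : ∀ k, 1 ≤ k → IsUnit (wr d f k)) (k : ℕ) : IsUnit (wr d f k) := by
  cases k with
  | zero => rw [wr_zero]; exact isUnit_one
  | succ k => exact hu _ (by omega)

/-- The recursion `B_{j+1} = (∂ - ∂ ln (W_{j+1}/W_j)) B_j` for `B_j(g) = W_j(g)/W_j`. -/
theorem wrExt_succ (hu : ∀ k, 1 ≤ k → IsUnit (wr d f k)) (j : ℕ) (g : R) :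
    wrExt d f (j + 1) g * Ring.inverse (wr d f (j + 1)) =
      d (wrExt d f j g * Ring.inverse (wr d f j)) -
        dlog d (wr d f (j + 1) * Ring.inverse (wr d f j)) *
          (wrExt d f j g * Ring.inverse (wr d f j)) := by
  have hj := isUnit_wr hu j
  have hj1 := isUnit_wr hu (j + 1)
  obtain ⟨a, ha, haE⟩ := exists_wrExt_eq_sum d f (j + 1)
  obtain ⟨b, hb, hbE⟩ := exists_wrExt_eq_sum d f j
  set v := Ring.inverse (wr d f j)
  set w := Ring.inverse (wr d f (j + 1))
  set p := dlog d (wr d f (j + 1) * v)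
  have hv : wr d f j * v = 1 := Ring.mul_inverse_cancel _ hj
  have hw : wr d f (j + 1) * w = 1 := Ring.mul_inverse_cancel _ hj1
  -- Both sides are monic operators of order j + 1 acting on g. The leading terms cancel, and `c`
  -- collects the remaining coefficients of the difference; `b'` comes from raising the powers of ∂
  -- by one.
  let b' : ℕ → R := fun m => Nat.casesOn m 0 fun m => b m * v
  let c : ℕ → R := fun m => a m * w - d (b m * v) - b' m + p * (b m * v)
  have hE : ∀ g, wrExt d f (j + 1) g * w - (d (wrExt d f j g * v) - p * (wrExt d f j g * v)) =
      ∑ m ∈ Finset.range (j + 1), c m * d^[m] g := by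
    intro g
    have h1 : wrExt d f (j + 1) g * w =
        ∑ m ∈ Finset.range (j + 1), a m * w * d^[m] g + d^[j + 1] g := by
      rw [haE, Finset.sum_range_succ, add_mul, Finset.sum_mul, ha]
      congr 1
      · exact Finset.sum_congr rfl fun _ _ => by ring
      · linear_combination d^[j + 1] g * hw
    have h2 : wrExt d f j g * v = ∑ m ∈ Finset.range (j + 1), b m * v * d^[m] g := by
      rw [hbE, Finset.sum_mul]
      exact Finset.sum_congr rfl fun _ _ => by ring
    have h3 : d (wrExt d f j g * v) = ∑ m ∈ Finset.range (j + 1), d (b m * v) * d^[m] g +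
        (∑ m ∈ Finset.range (j + 1), b' m * d^[m] g + d^[j + 1] g) := by
      have h4 : ∑ m ∈ Finset.range (j + 1), b' m * d^[m] g + d^[j + 1] g =
          ∑ m ∈ Finset.range (j + 1), b m * v * d^[m + 1] g := by
        rw [Finset.sum_range_succ', Finset.sum_range_succ, hb, hv]
        simp [b']
      rw [h2, map_sum, h4, ← Finset.sum_add_distrib]
      refine Finset.sum_congr rfl fun m _ => ?_
      rw [Derivation.leibniz, smul_eq_mul, smul_eq_mul, Function.iterate_succ_apply']
      ring
    rw [h1, h3, h2, Finset.mul_sum]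
    simp only [c, sub_mul, add_mul, Finset.sum_add_distrib, Finset.sum_sub_distrib, mul_assoc]
    ring
  -- The difference has order at most j and annihilates f₁, …, f_{j+1}: for the first j functions
  -- both Wronskians have a repeated column, and f_{j+1} is killed by the new first-order factor.
  have hc := eq_zero_of_sum_mul_iterate hj1 (c := c) (fun i hi => by
    rw [← hE, wrExt_eq_zero d f hi]
    rcases Nat.lt_succ_iff_lt_or_eq.1 hi with h | rfl
    · rw [wrExt_eq_zero d f h]; simp
    · rw [wrExt_self]
      have hq : IsUnit (wr d f (i + 1) * v) := hj1.mul hj.ringInverse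
      have := Ring.inverse_mul_cancel _ hq
      simp only [p, dlog]
      linear_combination d (wr d f (i + 1) * v) * this)
  have := hE g
  rw [Finset.sum_eq_zero fun m hm => by rw [hc m (Finset.mem_range.1 hm), zero_mul]] at this
  exact sub_eq_zero.1 this

end wronskian

/-! ### Elimination

For a sequence `f₀, f₁, …` of functions and a sequence `T₀, T₁, …` in an `R`-module, the first
members are eliminated one after the other. -/

section elimination
variable {N : Type*} [AddCommGroup N] [Module R N]

/-- `f_{k+1} ↦ (∂ - ∂ ln f₀) f_{k+1}`. -/
noncomputable def red (d : Derivation ℤ R R) (f : ℕ → R) : ℕ → R :=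
  fun k => d (f (k + 1)) - dlog d (f 0) * f (k + 1)

/-- `T_{k+1} ↦ T_{k+1} - (f_{k+1}/f₀) T₀`. -/
noncomputable def redMod (f : ℕ → R) (T : ℕ → N) : ℕ → N :=
  fun k => T (k + 1) - (f (k + 1) * Ring.inverse (f 0)) • T 0

/-- The iterates of `red`. -/
noncomputable def iterRed (d : Derivation ℤ R R) (f : ℕ → R) : ℕ → ℕ → R
  | 0 => f
  | j + 1 => red d (iterRed d f j)

/-- The iterates of `redMod`. -/
noncomputable def iterRedMod (d : Derivation ℤ R R) (f : ℕ → R) (T : ℕ → N) : ℕ → ℕ → N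
  | 0 => T
  | j + 1 => redMod (iterRed d f j) (iterRedMod d f T j)

variable {d e : Derivation ℤ R R}

theorem iterRed_eq_wrExt {f : ℕ → R} (hu : ∀ k, 1 ≤ k → IsUnit (wr d f k)) (j i : ℕ) :
    iterRed d (fun k => f (k + 1)) j i =
      wrExt d f j (f (i + j + 1)) * Ring.inverse (wr d f j) := by
  induction j generalizing i with
  | zero => simp [iterRed, wr_zero, wrExt, wronskian, Fin.snoc]
  | succ j ih =>
    rw [wrExt_succ hu, iterRed, red, ih, ih, zero_add, wrExt_self,
      show i + 1 + j + 1 = i + (j + 1) + 1 by ring]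

theorem iterRed_zero_eq_wr {f : ℕ → R} (hu : ∀ k, 1 ≤ k → IsUnit (wr d f k)) (j : ℕ) :
    iterRed d (fun k => f (k + 1)) j 0 = wr d f (j + 1) * Ring.inverse (wr d f j) := by
  rw [iterRed_eq_wrExt hu, zero_add, wrExt_self]

theorem isUnit_iterRed {f : ℕ → R} (hu : ∀ k, 1 ≤ k → IsUnit (wr d f k)) (j : ℕ) :
    IsUnit (iterRed d (fun k => f (k + 1)) j 0) := by
  rw [iterRed_zero_eq_wr hu]
  exact (isUnit_wr hu _).mul (isUnit_wr hu _).ringInverse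

/-- A flow `∂f_k/∂t̄ = f_{k+1} + s_k f₀` with `∂s_k = φ f_k`. -/
structure ShiftFlow (d e : Derivation ℤ R R) (f s : ℕ → R) (φ : R) : Prop where
  flow : ∀ k, e (f k) = f (k + 1) + s k * f 0
  grad : ∀ k, d (s k) = φ * f k

/-- The shape of the flow survives elimination, with new data s_k = -f_{k+1}/f₀ and φ = -1/f₀. This
is what allows elimination to be iterated. -/
theorem ShiftFlow.of_red (hde : ∀ f, e (d f) = d (e f)) {f s : ℕ → R} {φ : R}
    (h : ShiftFlow d e f s φ) (hf : IsUnit (f 0)) :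
    ShiftFlow d e (red d f) (fun k => -(f (k + 1) * Ring.inverse (f 0))) (-Ring.inverse (f 0)) := by
  have hv := Ring.mul_inverse_cancel _ hf
  constructor
  · intro k
    simp only [red, dlog, map_sub, Derivation.leibniz, smul_eq_mul, hde, h.flow, map_add,
      derivation_inverse e hf, h.grad]
    linear_combination (-φ * f (k + 1) * f 0 - s (k + 1) * d (f 0) +
      s 0 * d (f 0) * Ring.inverse (f 0) * f (k + 1)) * hv
  · intro k
    simp only [red, dlog, map_neg, Derivation.leibniz, smul_eq_mul,
      derivation_inverse d hf]
    ring

variable {nab : N →+ N}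

theorem ShiftFlow.nab_redMod (hnab : ∀ (r : R) n, nab (r • n) = e r • n + r • nab n) {f s : ℕ → R}
    {φ : R} (h : ShiftFlow d e f s φ) (hf : IsUnit (f 0)) {T : ℕ → N}
    (hT : ∀ k, nab (T k) = T (k + 1) + s k • T 0) (k : ℕ) :
    nab (redMod f T k) =
      redMod f T (k + 1) + (-(f (k + 1) * Ring.inverse (f 0))) • redMod f T 0 := by
  have hv := Ring.mul_inverse_cancel _ hf
  have he : e (f (k + 1) * Ring.inverse (f 0)) = f (k + 2) * Ring.inverse (f 0) + s (k + 1) -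
      f (k + 1) * Ring.inverse (f 0) * (f 1 * Ring.inverse (f 0) + s 0) := by
    simp only [Derivation.leibniz, smul_eq_mul, derivation_inverse e hf, h.flow]
    linear_combination (s (k + 1) - f (k + 1) * Ring.inverse (f 0) * s 0) * hv
  simp only [redMod, map_sub, hnab, hT, he]
  module

theorem ShiftFlow.exists_nab_iterRedMod (hde : ∀ f, e (d f) = d (e f))
    (hnab : ∀ (r : R) n, nab (r • n) = e r • n + r • nab n) {f s : ℕ → R}
    {φ : R} (h : ShiftFlow d e f s φ) (hf : ∀ j, IsUnit (iterRed d f j 0)) {T : ℕ → N}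
    (hT : ∀ k, nab (T k) = T (k + 1) + s k • T 0) (j : ℕ) :
    ∃ s' φ', ShiftFlow d e (iterRed d f j) s' φ' ∧
      ∀ k, nab (iterRedMod d f T j k) = iterRedMod d f T j (k + 1) + s' k • iterRedMod d f T j 0 := by
  induction j with
  | zero => exact ⟨s, φ, h, hT⟩
  | succ j ih =>
    obtain ⟨s', φ', h', hT'⟩ := ih
    exact ⟨_, _, h'.of_red hde (hf j), h'.nab_redMod hnab (hf j) hT'⟩

/-- The recursion `(∇ - ∂̄ ln q_j) τ_j = τ_{j+1}`. -/
theorem ShiftFlow.nab_iterRedMod (hde : ∀ f, e (d f) = d (e f))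
    (hnab : ∀ (r : R) n, nab (r • n) = e r • n + r • nab n) {f s : ℕ → R}
    {φ : R} (h : ShiftFlow d e f s φ) (hf : ∀ j, IsUnit (iterRed d f j 0)) {T : ℕ → N}
    (hT : ∀ k, nab (T k) = T (k + 1) + s k • T 0) (j : ℕ) :
    nab (iterRedMod d f T j 0) -
        dlog e (iterRed d f j 0) • iterRedMod d f T j 0 =
      iterRedMod d f T (j + 1) 0 := by
  obtain ⟨s', φ', h', hT'⟩ := h.exists_nab_iterRedMod hde hnab hf hT j
  have hv := Ring.mul_inverse_cancel _ (hf j)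
  have he : dlog e (iterRed d f j 0) = iterRed d f j 1 *
      Ring.inverse (iterRed d f j 0) + s' 0 := by
    rw [dlog, h'.flow]
    linear_combination s' 0 * hv
  rw [hT', he, iterRedMod, redMod]
  module

/-- A triangular expansion in the style of Newton interpolation: each step of elimination splits off
the multiple of the current first member. -/
theorem eq_sum_iterRedMod {f : ℕ → R} (hf : ∀ j, IsUnit (iterRed d f j 0)) (T : ℕ → N) (k j : ℕ) :
    iterRedMod d f T j k = ∑ i ∈ Finset.range (k + 1),
      (iterRed d f (j + i) (k - i) * Ring.inverse (iterRed d f (j + i) 0)) •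
        iterRedMod d f T (j + i) 0 := by
  induction k generalizing j with
  | zero => simp [Ring.mul_inverse_cancel _ (hf j)]
  | succ k ih =>
    rw [Finset.sum_range_succ']
    have := ih (j + 1)
    simp only [Nat.add_sub_add_right, ← add_assoc, add_right_comm j _ 1] at this ⊢
    rw [← this, iterRedMod, redMod]
    simp

/-- The terms of the ghost Zakharov-Shabat operator, applied to an element of an `R`-module with a
connection `∇` along `e`. -/
theorem sum_ghost_terms {Φ Ψ : ℕ → R} (hu : ∀ k, 1 ≤ k → IsUnit (wr d Ψ k))
    (hde : ∀ f, e (d f) = d (e f))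
    (hnab : ∀ (r : R) n, nab (r • n) = e r • n + r • nab n) {σ : ℕ → R} {φ : R}
    (hΨ : ∀ k, 1 ≤ k → e (Ψ k) = Ψ (k + 1) + σ k * Ψ 1) (hσ : ∀ k, 1 ≤ k → d (σ k) = φ * Ψ k)
    {T : ℕ → N} (hT : ∀ k, 1 ≤ k → nab (T k) = T (k + 1) + σ k • T 1) {g : ℕ → N}
    (hg1 : g 1 = T 1)
    (hg : ∀ j, g (j + 2) = nab (g (j + 1)) -
      dlog e (wr d Ψ (j + 1) * Ring.inverse (wr d Ψ j)) • g (j + 1)) (s : ℕ) :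
    ∑ j ∈ Finset.Icc 1 s, (∑ k ∈ Finset.Icc j s, Φ (s - k + 1) * Ring.inverse (Φ 1) *
      (wrExt d Ψ (j - 1) (Ψ k) * Ring.inverse (wr d Ψ j))) • g j =
    ∑ k ∈ Finset.Icc 1 s, (Φ (s - k + 1) * Ring.inverse (Φ 1)) • T k := by
  have hflow : ShiftFlow d e (fun k => Ψ (k + 1)) (fun k => σ (k + 1)) φ :=
    ⟨fun k => hΨ (k + 1) (by omega), fun k => hσ (k + 1) (by omega)⟩
  have hf := isUnit_iterRed hu
  have hgT : ∀ j, g (j + 1) = iterRedMod d (fun k => Ψ (k + 1)) (fun k => T (k + 1)) j 0 := by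
    intro j
    induction j with
    | zero => exact hg1
    | succ j ih =>
      rw [hg, ih, ← iterRed_zero_eq_wr hu,
        hflow.nab_iterRedMod hde hnab hf (fun k => hT (k + 1) (by omega))]
  have hTk : ∀ k, 1 ≤ k → T k =
      ∑ j ∈ Finset.Icc 1 k, (wrExt d Ψ (j - 1) (Ψ k) * Ring.inverse (wr d Ψ j)) • g j := by
    intro k hk
    obtain ⟨k, rfl⟩ : ∃ m, k = m + 1 := ⟨k - 1, by omega⟩
    have := eq_sum_iterRedMod hf (fun k => T (k + 1)) k 0
    rw [iterRedMod] at this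
    rw [this, sum_Icc_one]
    refine Finset.sum_congr rfl fun i hi => ?_
    rw [Finset.mem_range] at hi
    rw [hgT, zero_add, Nat.add_sub_cancel, iterRed_eq_wrExt hu, iterRed_zero_eq_wr hu,
      show k - i + i + 1 = k + 1 by omega]
    congr 1
    rw [Ring.mul_inverse_rev, Ring.inverse_inverse (isUnit_wr hu i)]
    have := Ring.inverse_mul_cancel _ (isUnit_wr hu i)
    linear_combination wrExt d Ψ i (Ψ (k + 1)) * Ring.inverse (wr d Ψ (i + 1)) * this
  have h1 : ∀ k ∈ Finset.Icc 1 s, (Φ (s - k + 1) * Ring.inverse (Φ 1)) • T k =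
      ∑ j ∈ Finset.Icc 1 k, (Φ (s - k + 1) * Ring.inverse (Φ 1) *
        (wrExt d Ψ (j - 1) (Ψ k) * Ring.inverse (wr d Ψ j))) • g j := by
    intro k hk
    rw [Finset.mem_Icc] at hk
    rw [hTk k hk.1, Finset.smul_sum]
    exact Finset.sum_congr rfl fun j _ => by rw [smul_smul]
  rw [Finset.sum_congr rfl h1]
  simp only [Finset.sum_smul]
  refine Finset.sum_comm' fun j k => ?_
  simp only [Finset.mem_Icc]
  omega

end elimination

/-! ### Iterated primitives -/

section primitives
variable {d e : Derivation ℤ R R}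

/-- Presents an iterated integral by the list of its successive inner integrals, the innermost being
1. -/
theorem isIteratedPrimitive_of_chain (e : Derivation ℤ R R) (n : ℕ) (h Q : ℕ → R)
    (hQ : ∀ j < n, e (Q j) = h j * Q (j + 1)) (hn : Q n = 1) :
    IsIteratedPrimitive e ((List.range n).map h) (Q 0) := by
  induction n generalizing h Q with
  | zero => exact hn
  | succ n ih =>
    rw [List.range_succ_eq_map, List.map_cons, List.map_map]
    exact ⟨Q 1, ih (h ∘ Nat.succ) (fun j => Q (j + 1)) (fun j hj => hQ (j + 1) (by omega)) hn,
      hQ 0 (by omega)⟩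

/-- The successive coefficients `u` in `T_{l+1} = u_l f + ε ∂T_l`. -/
noncomputable def iterCoeff (d : Derivation ℤ R R) (ε : R) (f : ℕ → R) (T : ℕ → ℕ → R) (u : ℕ → R) :
    ℕ → ℕ → R
  | 0, l => u l
  | j + 1, l => ε * (iterRedMod d f (T l) j 0 * Ring.inverse (iterRed d f j 0))

variable {ε : R} {f : ℕ → R} {T : ℕ → ℕ → R} {u : ℕ → R}

/-- Elimination removes the term u_l f. The derivative of the ratio f_{k+1}/f₀ is the reduced
function over f₀, so a term of the same form reappears, with coefficient ε T_l/f₀ taken at index 0.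
-/
theorem iterRedMod_succ (hf : ∀ j, IsUnit (iterRed d f j 0))
    (hT : ∀ l k, T (l + 1) k = u l * f k + ε * d (T l k)) (j l k : ℕ) :
    iterRedMod d f (T (l + 1)) j k =
      iterCoeff d ε f T u j l * iterRed d f j k + ε * d (iterRedMod d f (T l) j k) := by
  induction j generalizing l k with
  | zero => exact hT l k
  | succ j ih =>
    have hv := Ring.mul_inverse_cancel _ (hf j)
    rw [iterRedMod, iterRedMod, redMod, redMod, ih, ih, iterCoeff, iterRed, red, dlog]
    simp only [smul_eq_mul, map_sub, Derivation.leibniz, derivation_inverse d (hf j)]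
    linear_combination (-iterRed d f j (k + 1) * iterCoeff d ε f T u j l) * hv

/-- After j steps the first nonzero layer is a multiple of the function to be eliminated next, so
that each step kills one more layer. -/
theorem iterRedMod_eq_zero (hf : ∀ j, IsUnit (iterRed d f j 0))
    (hT : ∀ l k, T (l + 1) k = u l * f k + ε * d (T l k)) (hT0 : ∀ k, T 0 k = 0) (j l k : ℕ)
    (hl : l ≤ j) : iterRedMod d f (T l) j k = 0 := by
  induction j generalizing l k with
  | zero =>
    obtain rfl : l = 0 := by omega
    exact hT0 k
  | succ j ih =>
    rw [iterRedMod, redMod]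
    rcases Nat.lt_or_ge j l with h | h
    · obtain rfl : l = j + 1 := by omega
      rw [iterRedMod_succ hf hT, iterRedMod_succ hf hT, ih _ _ le_rfl, ih _ _ le_rfl]
      have hv := Ring.mul_inverse_cancel _ (hf j)
      simp only [map_zero, mul_zero, add_zero, smul_eq_mul]
      linear_combination (-iterRed d f j (k + 1) * iterCoeff d ε f T u j j) * hv
    · rw [ih _ _ h, ih _ _ h, smul_zero, sub_zero]

/-- This constant ends the chain of integrals. -/
theorem iterCoeff_diag (hf : ∀ j, IsUnit (iterRed d f j 0))
    (hT : ∀ l k, T (l + 1) k = u l * f k + ε * d (T l k)) (hT0 : ∀ k, T 0 k = 0) (j : ℕ) :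
    iterCoeff d ε f T u j j = ε ^ j * u 0 := by
  induction j with
  | zero => simp [iterCoeff]
  | succ j ih =>
    have hv := Ring.mul_inverse_cancel _ (hf j)
    rw [iterCoeff, iterRedMod_succ hf hT, iterRedMod_eq_zero hf hT hT0 _ _ _ le_rfl, ih,
      map_zero, pow_succ]
    linear_combination (ε * ε ^ j * u 0) * hv

/-- Dividing by q_j turns ∂̄ - ∂̄ ln q_j into ∂̄, so (τ_j/q_j) has derivative τ_{j+1}/q_j =
(q_{j+1}/q_j)(τ_{j+1}/q_{j+1}). The factor q_{j+1}/q_j is the integrand of the dual systems. -/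
theorem ShiftFlow.derivation_iterCoeff (hde : ∀ f, e (d f) = d (e f)) (hε : e ε = 0) {s : ℕ → R} {φ : R}
    (h : ShiftFlow d e f s φ) (hf : ∀ j, IsUnit (iterRed d f j 0))
    (hT : ∀ l k, e (T l k) = T l (k + 1) + s k * T l 0) (j l : ℕ) :
    e (iterCoeff d ε f T u (j + 1) l) = iterRed d f (j + 1) 0 *
      Ring.inverse (iterRed d f j 0) * iterCoeff d ε f T u (j + 2) l := by
  have h1 := h.nab_iterRedMod (nab := (e : R →+ R)) hde
    (fun r n => by simp [mul_comm, add_comm]) hf (T := T l) (fun k => hT l k) j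
  have hv := Ring.mul_inverse_cancel _ (hf (j + 1))
  simp only [iterCoeff]
  rw [← h1]
  simp only [Derivation.leibniz, smul_eq_mul, derivation_inverse e (hf j), hε, dlog,
    AddMonoidHom.coe_coe]
  linear_combination (-ε * (e (iterRedMod d f (T l) j 0) - e (iterRed d f j 0) *
    Ring.inverse (iterRed d f j 0) * iterRedMod d f (T l) j 0) *
    Ring.inverse (iterRed d f j 0)) * hv

end primitives

/-- A KP dressing operator with eigenfunctions `Φ`, adjoint eigenfunctions `Ψ`, their primitives
`S`, and the ghost flows generated by them. -/
structure GhostSystem (dt db : ℕ → Derivation ℤ R R) (W L : PDO (dt 1)) (Φ Ψ : ℕ → R)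
    (S : ℕ → ℕ → R) : Prop where
  htt : ∀ r s, 1 ≤ r → 1 ≤ s → ∀ f, dt r (dt s f) = dt s (dt r f)
  hbb : ∀ r s, 1 ≤ r → 1 ≤ s → ∀ f, db r (db s f) = db s (db r f)
  htb : ∀ r s, 1 ≤ r → 1 ≤ s → ∀ f, dt r (db s f) = db s (dt r f)
  hW : IsDressingForm W
  hL : L * W = W * D
  hWt : ∀ r, 1 ≤ r → W.diff (dt r) = -((L ^ r).minus * W)
  hΦ : ∀ k, 1 ≤ k → IsEigenfunction dt L (Φ k)
  hΨ : ∀ k, 1 ≤ k → IsAdjEigenfunction dt L (Ψ k)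
  hΦwr : ∀ k, 1 ≤ k → IsUnit (wr (dt 1) Φ k)
  hΨwr : ∀ k, 1 ≤ k → IsUnit (wr (dt 1) Ψ k)
  hS : ∀ k j, 1 ≤ k → 1 ≤ j → dt 1 (S k j) = Φ k * Ψ j
  hWb : ∀ s, 1 ≤ s → W.diff (db s) = ghostGenerator (dt 1) Φ Ψ s * W
  hΦb : ∀ s k, 1 ≤ s → 1 ≤ k →
    db s (Φ k) = ∑ j ∈ Finset.Icc 1 s, Φ (s - j + 1) * S k j - Φ (k + s)
  hΨb : ∀ s k, 1 ≤ s → 1 ≤ k →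
    db s (Ψ k) = ∑ j ∈ Finset.Icc 1 s, Ψ j * S (s - j + 1) k + Ψ (k + s)

theorem sum_Icc_conv (a b : ℕ → R) (s : ℕ) :
    ∑ j ∈ Finset.Icc 1 s, a (s - j + 1) * b j = ∑ i ∈ Finset.range s, a (s - i) * b (i + 1) := by
  rw [sum_Icc_one]
  refine Finset.sum_congr rfl fun i hi => ?_
  rw [Finset.mem_range] at hi
  rw [show s - (i + 1) + 1 = s - i by omega]

theorem eq_zero_of_conv {a x : ℕ → R} (ha : IsUnit (a 1))
    (h : ∀ r, 1 ≤ r → ∑ i ∈ Finset.Icc 1 r, a (r - i + 1) * x i = 0) : ∀ i, 1 ≤ i → x i = 0 := by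
  intro i
  induction i using Nat.strong_induction_on with
  | _ i ih =>
    intro hi
    have := h i hi
    rw [Finset.sum_eq_single_of_mem i (Finset.mem_Icc.2 ⟨hi, le_rfl⟩), Nat.sub_self, zero_add] at this
    · exact ha.mul_right_eq_zero.1 this
    · intro j hj hji
      rw [Finset.mem_Icc] at hj
      rw [ih j (by omega) hj.1, mul_zero]

/-- Integration by parts. -/
theorem Dinv_mul_mulOp_deriv {d : Derivation ℤ R R} (f : R) :
    (Dinv * mulOp (d f) : PDO d) = mulOp f - Dinv * mulOp f * D := by
  rw [eq_sub_of_add_eq' (D_mul_mulOp f).symm, mul_sub, ← mul_assoc, Dinv_mul_D, one_mul, mul_assoc]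

theorem Dinv_mul_mulOp_deriv_mul_Dinv {d : Derivation ℤ R R} (f : R) :
    (Dinv * mulOp (d f) * Dinv : PDO d) = mulOp f * Dinv - Dinv * mulOp f := by
  rw [Dinv_mul_mulOp_deriv, sub_mul, mul_assoc _ D, D_mul_Dinv, mul_one]

theorem dlog_inverse (e : Derivation ℤ R R) {f : R} (hf : IsUnit f) :
    dlog e (Ring.inverse f) = -dlog e f := by
  rw [dlog, dlog, derivation_inverse e hf, Ring.inverse_inverse hf]
  linear_combination (-Ring.inverse f * e f) * Ring.inverse_mul_cancel f hf

theorem ghostGenerator_one (d : Derivation ℤ R R) (Φ Ψ : ℕ → R) :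
    ghostGenerator d Φ Ψ 1 = mulOp (Φ 1) * Dinv * mulOp (Ψ 1) := by
  simp [ghostGenerator]

theorem isDifferential_ghostFactor (d e : Derivation ℤ R R) (Φ Ψ : ℕ → R) (j : ℕ) :
    (ghostFactor d e Φ Ψ j).IsDifferential := by
  induction j using Nat.twoStepInduction with
  | zero => exact isDifferential_mulOp 1
  | one =>
    have h : (D : PDO e) = D * mulOp 1 := (mul_one _).symm
    rw [ghostFactor, h]
    exact (isDifferential_mulOp 1).D_mul.sub (isDifferential_mulOp _)
  | more j _ ih =>
    rw [ghostFactor, sub_mul]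
    exact ih.D_mul.sub (ih.mulOp_mul _)

theorem isDifferential_ghostZS (d e : ℕ → Derivation ℤ R R) (Φ Ψ : ℕ → R) (s : ℕ) :
    (ghostZS d e Φ Ψ s).IsDifferential :=
  (isDifferential_sum _ _ fun _ _ => (isDifferential_ghostFactor _ _ _ _ _).mulOp_mul _).sub
    (isDifferential_mulOp _)

/-! ### Evolution of primitives along t̄₁ and the action of M̄_s -/

namespace GhostSystem
variable {dt db : ℕ → Derivation ℤ R R} {W L : PDO (dt 1)} {Φ Ψ : ℕ → R} {S : ℕ → ℕ → R}

section
variable (h : GhostSystem dt db W L Φ Ψ S)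
include h

theorem isUnit_Φ : IsUnit (Φ 1) := by
  rw [← wr_one (dt 1) Φ]; exact h.hΦwr 1 le_rfl

theorem isUnit_Ψ : IsUnit (Ψ 1) := by
  rw [← wr_one (dt 1) Ψ]; exact h.hΨwr 1 le_rfl

theorem mul_inv : Φ 1 * Ring.inverse (Φ 1) = 1 := Ring.mul_inverse_cancel _ h.isUnit_Φ

theorem db_one_Φ (k : ℕ) (hk : 1 ≤ k) : db 1 (Φ k) = Φ 1 * S k 1 - Φ (k + 1) := by
  rw [h.hΦb 1 k le_rfl hk]; simp

theorem db_one_Ψ (k : ℕ) (hk : 1 ≤ k) : db 1 (Ψ k) = Ψ (k + 1) + S 1 k * Ψ 1 := by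
  rw [h.hΨb 1 k le_rfl hk]; simp; ring

/-- The `t̄₁`-evolution of primitives `T k j = ∂⁻¹(Ψ_j F_k)` is forced by the evolution of `F`. -/
theorem db_one_primitive {F : ℕ → R} {T : ℕ → ℕ → R}
    (hT : ∀ k j, 1 ≤ k → 1 ≤ j → dt 1 (T k j) = Ψ j * F k)
    (hF : ∀ s k, 1 ≤ s → 1 ≤ k →
      db s (F k) = ∑ j ∈ Finset.Icc 1 s, Φ (s - j + 1) * T k j - F (k + s))
    (k j : ℕ) (hk : 1 ≤ k) (hj : 1 ≤ j) :
    db 1 (T k j) = T k (j + 1) + S 1 j * T k 1 - T (k + 1) j := by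
  have hF1 : ∀ k, 1 ≤ k → db 1 (F k) = Φ 1 * T k 1 - F (k + 1) := fun k hk => by
    rw [hF 1 k le_rfl hk]; simp
  -- `X` and `Y` are the defects in the expected evolutions of T_{kj} along t̄₁ and of T_{k1} along
  -- t̄_s. Both have zero x-derivative, so only constants of integration are in question.
  set X : ℕ → R := fun j => db 1 (T k j) - (T k (j + 1) + S 1 j * T k 1 - T (k + 1) j)
  suffices hX : X j = 0 from sub_eq_zero.1 hX
  set s := j + 1
  set Y : R := db s (T k 1) - (∑ i ∈ Finset.range s, S (s - i) 1 * T k (i + 1) + T k (s + 1) -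
    T (k + s) 1)
  have hs : 1 ≤ s := by omega
  have hdX : ∀ j, 1 ≤ j → dt 1 (X j) = 0 := fun j hj => by
    simp only [X, map_sub, map_add, Derivation.leibniz, smul_eq_mul]
    rw [h.htb 1 1 le_rfl le_rfl, hT k j hk hj, hT k _ hk (by omega), hT k 1 hk le_rfl,
      hT (k + 1) j (by omega) hj, h.hS 1 j le_rfl hj, Derivation.leibniz, hF1 k hk, h.db_one_Ψ j hj,
      smul_eq_mul, smul_eq_mul]
    ring
  have hdY : dt 1 Y = 0 := by
    have e1 : dt 1 (∑ i ∈ Finset.range s, S (s - i) 1 * T k (i + 1)) =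
        Ψ 1 * ∑ i ∈ Finset.range s, Φ (s - i) * T k (i + 1) +
        (∑ i ∈ Finset.range s, S (s - i) 1 * Ψ (i + 1)) * F k := by
      rw [map_sum, Finset.mul_sum, Finset.sum_mul, ← Finset.sum_add_distrib]
      refine Finset.sum_congr rfl fun i hi => ?_
      rw [Finset.mem_range] at hi
      rw [Derivation.leibniz, hT k _ hk (by omega), h.hS _ 1 (by omega) le_rfl, smul_eq_mul,
        smul_eq_mul]
      ring
    have e2 : db s (Ψ 1) = ∑ i ∈ Finset.range s, S (s - i) 1 * Ψ (i + 1) + Ψ (1 + s) := by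
      rw [h.hΨb s 1 hs le_rfl, ← sum_Icc_conv (fun m => S m 1) Ψ]
      simp only [mul_comm]
    have e3 := hF s k hs hk
    rw [sum_Icc_conv] at e3
    simp only [Y, map_sub, map_add]
    rw [e1, h.htb 1 s le_rfl hs, hT k 1 hk le_rfl, Derivation.leibniz, e2, e3, smul_eq_mul,
      smul_eq_mul, hT k _ hk (by omega), hT (k + s) 1 (by omega) le_rfl, add_comm s 1]
    ring
  -- This is the commutation of ∂/∂t̄₁ and ∂/∂t̄_s on F_k; everything but the defects cancels.
  have key : ∑ i ∈ Finset.range s, Φ (s - i) * X (i + 1) = Φ 1 * Y := by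
    have e1 := h.hbb 1 s le_rfl hs (F k)
    have e3 := hF s k hs hk
    have e4 := hF s (k + 1) hs (by omega)
    have e5 := h.hΦb s 1 hs le_rfl
    rw [sum_Icc_conv] at e3 e4 e5
    have e6 : db 1 (∑ i ∈ Finset.range s, Φ (s - i) * T k (i + 1)) =
        Φ 1 * (∑ i ∈ Finset.range s, S (s - i) 1 * T k (i + 1)) -
        ∑ i ∈ Finset.range s, Φ (s + 1 - i) * T k (i + 1) +
        (∑ i ∈ Finset.range s, Φ (s - i) * X (i + 1) +
          ∑ i ∈ Finset.range s, Φ (s - i) * T k (i + 2) +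
          (∑ i ∈ Finset.range s, Φ (s - i) * S 1 (i + 1)) * T k 1 -
          ∑ i ∈ Finset.range s, Φ (s - i) * T (k + 1) (i + 1)) := by
      rw [map_sum, Finset.mul_sum, Finset.sum_mul]
      simp only [← Finset.sum_add_distrib, ← Finset.sum_sub_distrib]
      refine Finset.sum_congr rfl fun i hi => ?_
      rw [Finset.mem_range] at hi
      rw [Derivation.leibniz, h.db_one_Φ _ (by omega), smul_eq_mul, smul_eq_mul,
        show s - i + 1 = s + 1 - i by omega]
      ring
    have e7 : ∑ i ∈ Finset.range s, Φ (s + 1 - i) * T k (i + 1) + Φ 1 * T k (s + 1) =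
        ∑ i ∈ Finset.range s, Φ (s - i) * T k (i + 2) + Φ (s + 1) * T k 1 := by
      have a1 := Finset.sum_range_succ (fun i => Φ (s + 1 - i) * T k (i + 1)) s
      have a2 := Finset.sum_range_succ' (fun i => Φ (s + 1 - i) * T k (i + 1)) s
      simp only [Nat.add_sub_cancel_left, Nat.add_sub_add_right, Nat.sub_zero, zero_add,
        add_assoc, Nat.reduceAdd] at a1 a2
      rw [← a1, a2]
    rw [e3, hF1 k hk, map_sub, map_sub, e6, hF1 _ (by omega), Derivation.leibniz, e5, e4,
      smul_eq_mul, smul_eq_mul, add_comm 1 s, show k + 1 + s = k + s + 1 by ring] at e1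
    simp only [Y]
    linear_combination e1 + e7
  -- The coefficient of Φ₁ mixes X_s with Y, so independence yields only X_i = 0 for i < s. Hence
  -- the choice s = j + 1, and the index 1 at the end.
  have := eq_zero_of_sum_mul_const (h.hΦwr s hs) (c := fun i => X (s - i) - if i = 0 then Y else 0)
    (fun i hi => by
      rw [map_sub, hdX _ (by omega)]; split_ifs <;> simp [hdY])
    (by
      have e1 : ∑ i ∈ Finset.range s, Φ (i + 1) * X (s - i) =
          ∑ i ∈ Finset.range s, Φ (s - i) * X (i + 1) := by
        rw [← Finset.sum_range_reflect]
        refine Finset.sum_congr rfl fun i hi => ?_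
        rw [Finset.mem_range] at hi
        rw [show s - 1 - i + 1 = s - i by omega, show s - (s - 1 - i) = i + 1 by omega]
      simp only [mul_sub, Finset.sum_sub_distrib]
      rw [e1, key, Finset.sum_eq_single_of_mem 0 (Finset.mem_range.2 hs)]
      · simp
      · intro i _ hi; simp [hi]) 1 (by omega)
  simpa [s] using this

theorem db_one_S (k j : ℕ) (hk : 1 ≤ k) (hj : 1 ≤ j) :
    db 1 (S k j) = S k (j + 1) + S 1 j * S k 1 - S (k + 1) j :=
  h.db_one_primitive (fun k j hk hj => by rw [h.hS k j hk hj, mul_comm]) h.hΦb k j hk hj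

/-- The ghost Zakharov-Shabat operator in an `R`-module with a connection `∇` along `t̄₁`. -/
theorem sum_ghost {N : Type*} [AddCommGroup N] [Module R N] {nab : N →+ N}
    (hnab : ∀ (r : R) n, nab (r • n) = db 1 r • n + r • nab n)
    {T : ℕ → N} (hT : ∀ k, 1 ≤ k → nab (T k) = T (k + 1) + S 1 k • T 1) {g : ℕ → N}
    (hg1 : g 1 = T 1)
    (hg : ∀ j, g (j + 2) = nab (g (j + 1)) -
      dlog (db 1) (wr (dt 1) Ψ (j + 1) * Ring.inverse (wr (dt 1) Ψ j)) • g (j + 1)) (s : ℕ) :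
    ∑ j ∈ Finset.Icc 1 s, (∑ k ∈ Finset.Icc j s, Φ (s - k + 1) * Ring.inverse (Φ 1) *
      (wrExt (dt 1) Ψ (j - 1) (Ψ k) * Ring.inverse (wr (dt 1) Ψ j))) • g j =
    ∑ k ∈ Finset.Icc 1 s, (Φ (s - k + 1) * Ring.inverse (Φ 1)) • T k :=
  sum_ghost_terms (φ := Φ 1) h.hΨwr (fun f => (h.htb 1 1 le_rfl le_rfl f).symm) hnab h.db_one_Ψ
    (fun k hk => h.hS 1 k le_rfl hk) hT hg1 hg s

/-- The elimination with N = R and ∇ = ∂̄. Only the t̄₁-evolution of F and T enters, so that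
functions such as w_l, which are not eigenfunctions of L, are covered too. -/
theorem ghostZS_plusApply {F : R} {T : ℕ → R} (hF : db 1 F = Φ 1 * T 1)
    (hT : ∀ k, 1 ≤ k → db 1 (T k) = T (k + 1) + S 1 k * T 1) (s : ℕ) :
    (ghostZS dt db Φ Ψ s).plusApply (F * Ring.inverse (Φ 1)) =
      (∑ k ∈ Finset.Icc 1 s, Φ (s - k + 1) * T k) * Ring.inverse (Φ 1) -
        dlog (db s) (Φ 1) * (F * Ring.inverse (Φ 1)) := by
  have hdiff := isDifferential_ghostFactor (dt 1) (db 1) Φ Ψ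
  rw [ghostZS, plusApply_sub, plusApply_mulOp, plusApply_sum]
  simp only [plusApply_mulOp_mul]
  congr 1
  have := h.sum_ghost (nab := (db 1 : R →+ R)) (fun r n => by simp [mul_comm, add_comm]) hT
    (g := fun j => (ghostFactor (dt 1) (db 1) Φ Ψ j).plusApply (F * Ring.inverse (Φ 1))) (by
      have hD : (D : PDO (db 1)) = D * mulOp 1 := (mul_one _).symm
      simp only [ghostFactor]
      rw [plusApply_sub, plusApply_mulOp, hD, plusApply_D_mul (isDifferential_mulOp 1),
        plusApply_mulOp, dlog_inverse _ h.isUnit_Φ, one_mul, Derivation.leibniz,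
        derivation_inverse _ h.isUnit_Φ, hF, dlog, smul_eq_mul, smul_eq_mul]
      linear_combination T 1 * h.mul_inv) (fun j => by
      simp only [ghostFactor]
      rw [sub_mul, plusApply_sub, plusApply_D_mul (hdiff _), plusApply_mulOp_mul]
      rfl) s
  simp only [smul_eq_mul] at this
  rw [this, Finset.sum_mul]
  exact Finset.sum_congr rfl fun _ _ => by ring

theorem ghostZS_plusApply_eq {F : R} {T : ℕ → R}
    (hF : ∀ s, 1 ≤ s → db s F = ∑ k ∈ Finset.Icc 1 s, Φ (s - k + 1) * T k)
    (hT : ∀ k, 1 ≤ k → db 1 (T k) = T (k + 1) + S 1 k * T 1) (s : ℕ) (hs : 1 ≤ s) :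
    db s (F * Ring.inverse (Φ 1)) =
      (ghostZS dt db Φ Ψ s).plusApply (F * Ring.inverse (Φ 1)) := by
  rw [h.ghostZS_plusApply (by rw [hF 1 le_rfl]; simp) hT, ← hF s hs, Derivation.leibniz,
    derivation_inverse _ h.isUnit_Φ, dlog, smul_eq_mul, smul_eq_mul]
  ring

end

/-! ### The dressing operator of the ghost Lax operator -/

/-- `1 + ∑_{l ≥ 1} (Φ_{l+1}/Φ₁) D̄^{-l}`. -/
noncomputable def ghostDressing (e : Derivation ℤ R R) (Φ : ℕ → R) : PDO e :=
  PDO.mk (fun n => if 0 < n then 0 else Φ ((-n).toNat + 1) * Ring.inverse (Φ 1))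
    ⟨0, fun _ hn => if_pos hn⟩

theorem coeff_ghostDressing_neg (e : Derivation ℤ R R) (Φ : ℕ → R) (l : ℕ) :
    (ghostDressing e Φ).coeff (-l) = Φ (l + 1) * Ring.inverse (Φ 1) := by
  simp [ghostDressing]

theorem orderLE_ghostDressing (e : Derivation ℤ R R) (Φ : ℕ → R) : (ghostDressing e Φ).OrderLE 0 :=
  fun _ hn => if_pos hn

theorem exists_eq_neg_or_pos (n : ℤ) : (∃ l : ℕ, n = -l) ∨ ∃ l : ℕ, n = l + 1 := by
  rcases le_or_gt n 0 with hn | hn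
  · exact Or.inl ⟨(-n).toNat, by omega⟩
  · exact Or.inr ⟨(n - 1).toNat, by omega⟩

/-- `D̄ʲ + ∑_{k ≥ 1} S_{kj} D̄^{1-k}`. -/
noncomputable def primitiveSeries (e : Derivation ℤ R R) (S : ℕ → ℕ → R) (j : ℕ) : PDO e :=
  PDO.mk (fun n => if 0 < n then (if n = j then 1 else 0) else S ((-n).toNat + 1) j)
    ⟨j, fun n hn => by rw [if_pos (by omega), if_neg (by omega)]⟩

theorem coeff_primitiveSeries_neg (e : Derivation ℤ R R) (S : ℕ → ℕ → R) (j l : ℕ) :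
    (primitiveSeries e S j).coeff (-l) = S (l + 1) j := by
  simp [primitiveSeries]

theorem coeff_primitiveSeries_pos (e : Derivation ℤ R R) (S : ℕ → ℕ → R) (j l : ℕ) :
    (primitiveSeries e S j).coeff (l + 1) = if l + 1 = j then 1 else 0 := by
  rw [primitiveSeries, coeff_mk, if_pos (by omega)]
  exact if_congr (by omega) rfl rfl

section
variable (h : GhostSystem dt db W L Φ Ψ S)
include h

theorem isDressingForm_ghostDressing : IsDressingForm (ghostDressing (db 1) Φ) :=
  ⟨by simpa [h.mul_inv] using coeff_ghostDressing_neg (db 1) Φ 0, orderLE_ghostDressing _ _⟩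

/-- The term -S_{k+1,j} in the evolution of S_{kj} is cancelled by the shift of powers in D̄, so
that the series obey the recursion required for the elimination. -/
theorem D_mul_primitiveSeries (j : ℕ) (hj : 1 ≤ j) :
    D * primitiveSeries (db 1) S j =
      primitiveSeries (db 1) S (j + 1) + S 1 j • primitiveSeries (db 1) S 1 := by
  refine ext_coeff fun n => ?_
  rw [coeff_D_mul, coeff_add, coeff_smul]
  rcases exists_eq_neg_or_pos n with ⟨l, rfl⟩ | ⟨l, rfl⟩
  · rw [show -(l : ℤ) - 1 = -(l + 1 : ℕ) by push_cast; ring]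
    simp only [coeff_primitiveSeries_neg]
    rw [h.db_one_S _ _ (by omega) hj]
    ring
  · simp only [coeff_primitiveSeries_pos, add_sub_cancel_right]
    cases l with
    | zero =>
      have := coeff_primitiveSeries_neg (db 1) S j 0
      simp only [Nat.cast_zero, neg_zero] at this ⊢
      rw [this]
      split_ifs <;> first | omega | simp
    | succ l =>
      rw [Nat.cast_succ, coeff_primitiveSeries_pos]
      split_ifs <;> first | omega | simp

theorem ghostFactor_one_mul_ghostDressing :
    ghostFactor (dt 1) (db 1) Φ Ψ 1 * ghostDressing (db 1) Φ = primitiveSeries (db 1) S 1 := by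
  refine ext_coeff fun n => ?_
  rw [ghostFactor, sub_mul, coeff_sub, coeff_D_mul, coeff_mulOp_mul, dlog_inverse _ h.isUnit_Φ]
  rcases exists_eq_neg_or_pos n with ⟨l, rfl⟩ | ⟨l, rfl⟩
  · rw [show -(l : ℤ) - 1 = -(l + 1 : ℕ) by push_cast; ring]
    simp only [coeff_primitiveSeries_neg, coeff_ghostDressing_neg]
    rw [Derivation.leibniz, derivation_inverse _ h.isUnit_Φ, h.db_one_Φ (l + 1) (by omega), dlog,
      smul_eq_mul, smul_eq_mul]
    linear_combination S (l + 1) 1 * h.mul_inv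
  · rw [coeff_primitiveSeries_pos, orderLE_ghostDressing _ _ _ (by omega), add_sub_cancel_right]
    cases l with
    | zero =>
      have := h.isDressingForm_ghostDressing.1
      simp [this]
    | succ l =>
      rw [orderLE_ghostDressing _ _ _ (by omega)]
      simp

/-- `M̄_s W̄ = ∂W̄/∂t̄_s + W̄ D̄ˢ`. -/
theorem ghostZS_mul_ghostDressing (s : ℕ) (hs : 1 ≤ s) :
    ghostZS dt db Φ Ψ s * ghostDressing (db 1) Φ =
      (ghostDressing (db 1) Φ).diff (db s) + ghostDressing (db 1) Φ * D ^ s := by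
  -- Here the module consists of the operators themselves, with left multiplication by D̄ as
  -- connection.
  have key := h.sum_ghost (nab := AddMonoidHom.mulLeft (D : PDO (db 1))) (fun r n => by
      simp only [AddMonoidHom.coe_mulLeft, smul_eq_mulOp_mul]
      rw [← mul_assoc, D_mul_mulOp, add_mul, add_comm, mul_assoc]) h.D_mul_primitiveSeries
    (g := fun j => ghostFactor (dt 1) (db 1) Φ Ψ j * ghostDressing (db 1) Φ)
    h.ghostFactor_one_mul_ghostDressing (fun j => by
      simp only [ghostFactor, AddMonoidHom.coe_mulLeft, smul_eq_mulOp_mul]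
      rw [sub_mul, sub_mul, mul_assoc, mul_assoc]) s
  have h1 : ghostZS dt db Φ Ψ s * ghostDressing (db 1) Φ =
      ∑ k ∈ Finset.Icc 1 s, (Φ (s - k + 1) * Ring.inverse (Φ 1)) • primitiveSeries (db 1) S k -
        mulOp (dlog (db s) (Φ 1)) * ghostDressing (db 1) Φ := by
    rw [ghostZS, sub_mul, Finset.sum_mul, ← key]
    simp only [mul_assoc, smul_eq_mulOp_mul]
  rw [h1, D_pow]
  refine ext_coeff fun n => ?_
  rw [coeff_sub, coeff_add, coeff_diff, coeff_mulOp_mul, coeff_mul_zpow, coeff_sum]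
  simp only [coeff_smul]
  rcases exists_eq_neg_or_pos n with ⟨l, rfl⟩ | ⟨l, rfl⟩
  · rw [show -(l : ℤ) - s = -(l + s : ℕ) by push_cast; ring]
    simp only [coeff_primitiveSeries_neg, coeff_ghostDressing_neg]
    rw [Derivation.leibniz, derivation_inverse _ h.isUnit_Φ, h.hΦb s (l + 1) hs (by omega), dlog,
      smul_eq_mul, smul_eq_mul, show l + s + 1 = l + 1 + s by ring]
    have : ∑ k ∈ Finset.Icc 1 s, Φ (s - k + 1) * Ring.inverse (Φ 1) * S (l + 1) k =
        (∑ k ∈ Finset.Icc 1 s, Φ (s - k + 1) * S (l + 1) k) * Ring.inverse (Φ 1) := by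
      rw [Finset.sum_mul]
      exact Finset.sum_congr rfl fun _ _ => by ring
    rw [this]
    ring
  · rw [orderLE_ghostDressing _ _ _ (by omega)]
    simp only [coeff_primitiveSeries_pos, map_zero, mul_zero, zero_add, sub_zero, mul_ite, mul_one]
    rw [Finset.sum_ite_eq]
    split_ifs with hl
    · rw [Finset.mem_Icc] at hl
      rw [show (l : ℤ) + 1 - s = -(s - (l + 1) : ℕ) by omega, coeff_ghostDressing_neg]
    · rw [Finset.mem_Icc] at hl
      rw [orderLE_ghostDressing _ _ _ (by omega)]

/-- L̄ˢ = W̄ D̄ˢ W̄⁻¹ = M̄_s - (∂W̄/∂t̄_s) W̄⁻¹. The second term has order at most -1 because W̄ is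
monic of order 0. -/
theorem isGhostLax_dressing {V : PDO (db 1)} (hV : IsDressingForm V)
    (hWV : ghostDressing (db 1) Φ * V = 1) (hVW : V * ghostDressing (db 1) Φ = 1) :
    IsGhostLax dt db Φ Ψ (ghostDressing (db 1) Φ * D * V) := by
  set Wb := ghostDressing (db 1) Φ
  refine ⟨isLaxForm_of_dressing h.isDressingForm_ghostDressing hV hVW, fun s hs => ?_⟩
  refine plus_eq_of_add (C := -(Wb.diff (db s) * V)) ?_ (isDifferential_ghostZS _ _ _ _ _) ?_
  · have h1 := pow_mul_dressing (W := Wb) (L := Wb * D * V) (by rw [mul_assoc, hVW, mul_one]) s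
    calc (Wb * D * V) ^ s = (Wb * D * V) ^ s * Wb * V := by rw [mul_assoc _ Wb V, hWV, mul_one]
      _ = (ghostZS dt db Φ Ψ s * Wb - Wb.diff (db s)) * V := by
        rw [h1, h.ghostZS_mul_ghostDressing s hs, add_sub_cancel_left]
      _ = _ := by rw [sub_mul, mul_assoc _ Wb V, hWV, mul_one, sub_eq_add_neg]
  · have h2 : (Wb.diff (db s)).OrderLE (-1) := fun n hn => by
      rcases eq_or_lt_of_le (show 0 ≤ n by omega) with h0 | h0
      · rw [coeff_diff, ← h0, h.isDressingForm_ghostDressing.1, Derivation.map_one_eq_zero]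
      · rw [coeff_diff, orderLE_ghostDressing _ _ _ h0, map_zero]
    have h3 := h2.mul hV.orderLE
    intro n hn
    rw [coeff_neg, h3 n (by omega), neg_zero]

theorem eq_dressing_of_isGhostLax [Algebra ℚ R] {V Lb : PDO (db 1)} (hV : IsDressingForm V)
    (hWV : ghostDressing (db 1) Φ * V = 1) (hVW : V * ghostDressing (db 1) Φ = 1)
    (hLb : IsGhostLax dt db Φ Ψ Lb) : Lb = ghostDressing (db 1) Φ * D * V := by
  have h1 := h.isGhostLax_dressing hV hWV hVW
  exact eq_of_plus_pow_eq hLb.1 h1.1 fun s hs => (hLb.2 s hs).trans (h1.2 s hs).symm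

end
end GhostSystem

theorem ghostGenerator_mul {d : Derivation ℤ R R} (Φ Ψ : ℕ → R) (s : ℕ) (W : PDO d) :
    ghostGenerator d Φ Ψ s * W =
      ∑ j ∈ Finset.Icc 1 s, mulOp (Φ (s - j + 1)) * (Dinv * mulOp (Ψ j) * W) := by
  simp only [ghostGenerator, Finset.sum_mul, mul_assoc]

namespace GhostSystem
variable {dt db : ℕ → Derivation ℤ R R} {W L : PDO (dt 1)} {Φ Ψ : ℕ → R} {S : ℕ → ℕ → R}

/-! ### The dual eigenfunctions -/

/-- The coefficient of `D^{-l}` in `D⁻¹ Ψ_j W`. -/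
noncomputable def primCoeff {d : Derivation ℤ R R} (W : PDO d) (Ψ : ℕ → R) (j l : ℕ) : R :=
  (Dinv * mulOp (Ψ j) * W).coeff (-l)

/-- `Φ̄_l = w_{l-1}/Φ₁`. -/
noncomputable def dualEigen {d : Derivation ℤ R R} (W : PDO d) (Φ : ℕ → R) (l : ℕ) : R :=
  W.coeff (-(l - 1 : ℕ)) * Ring.inverse (Φ 1)

theorem primCoeff_succ {d : Derivation ℤ R R} (W : PDO d) (Ψ : ℕ → R) (j l : ℕ) :
    primCoeff W Ψ j (l + 1) = Ψ j * W.coeff (-l) - d (primCoeff W Ψ j l) := by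
  have h := coeff_D_mul (Dinv * mulOp (Ψ j) * W) (-l)
  rw [← mul_assoc, ← mul_assoc, D_mul_Dinv, one_mul, coeff_mulOp_mul] at h
  rw [h, primCoeff, primCoeff, Nat.cast_succ, neg_add']
  ring

theorem orderLE_Dinv_mul {d : Derivation ℤ R R} {A : PDO d} {N : ℤ} (hA : A.OrderLE N) (f : R) :
    (Dinv * mulOp f * A).OrderLE (N - 1) := by
  have := ((orderLE_monomial (-1) (1 : R)).mul (orderLE_mulOp (d := d) f)).mul hA
  exact this.mono (by omega)

section
variable (h : GhostSystem dt db W L Φ Ψ S)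
include h

theorem primCoeff_zero (j : ℕ) : primCoeff W Ψ j 0 = 0 :=
  orderLE_Dinv_mul h.hW.orderLE _ _ (by simp)

theorem primCoeff_one (j : ℕ) : primCoeff W Ψ j 1 = Ψ j := by
  have := primCoeff_succ W Ψ j 0
  rw [zero_add, h.primCoeff_zero] at this
  rw [this]
  simp [h.hW.1]

theorem mul_dualEigen (l : ℕ) : Φ 1 * dualEigen W Φ (l + 1) = W.coeff (-l) := by
  rw [dualEigen, Nat.add_sub_cancel]
  linear_combination W.coeff (-l) * h.mul_inv

theorem dualEigen_one : dualEigen W Φ 1 = Ring.inverse (Φ 1) := by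
  simp [dualEigen, h.hW.1]

theorem db_coeff (s : ℕ) (hs : 1 ≤ s) (l : ℕ) :
    db s (W.coeff (-l)) = ∑ j ∈ Finset.Icc 1 s, Φ (s - j + 1) * primCoeff W Ψ j l := by
  have := congrArg (fun A => A.coeff (-(l : ℤ))) (h.hWb s hs)
  simpa only [coeff_diff, ghostGenerator_mul, coeff_sum, coeff_mulOp_mul, primCoeff] using this

theorem db_one_coeff (l : ℕ) : db 1 (W.coeff (-l)) = Φ 1 * primCoeff W Ψ 1 l := by
  rw [h.db_coeff 1 le_rfl]; simp

/-- Differentiating D⁻¹Ψ_jW produces D⁻¹Ψ_jΦ₁D⁻¹Ψ₁W. Integration by parts with the primitive S_{1j}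
of Φ₁Ψ_j reduces it to a single D⁻¹. -/
theorem db_one_primCoeff (j : ℕ) (hj : 1 ≤ j) (l : ℕ) :
    db 1 (primCoeff W Ψ j l) = primCoeff W Ψ (j + 1) l + S 1 j * primCoeff W Ψ 1 l := by
  have hc : ∀ f, db 1 (dt 1 f) = dt 1 (db 1 f) := fun f => (h.htb 1 1 le_rfl le_rfl f).symm
  have h1 : (Dinv * mulOp (Ψ j) * W).diff (db 1) =
      Dinv * mulOp (Ψ (j + 1)) * W + mulOp (S 1 j) * (Dinv * mulOp (Ψ 1) * W) := by
    have e1 : (Dinv * mulOp (Ψ j) * mulOp (Φ 1) * Dinv : PDO (dt 1)) =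
        mulOp (S 1 j) * Dinv - Dinv * mulOp (S 1 j) := by
      rw [← Dinv_mul_mulOp_deriv_mul_Dinv, h.hS 1 j le_rfl hj, mul_assoc Dinv, mulOp_mul_mulOp,
        mul_comm (Ψ j)]
    have e2 : (Dinv * mulOp (Ψ j) : PDO (dt 1)) * (mulOp (Φ 1) * Dinv * mulOp (Ψ 1) * W) =
        (Dinv * mulOp (Ψ j) * mulOp (Φ 1) * Dinv) * mulOp (Ψ 1) * W := by
      simp only [mul_assoc]
    rw [diff_mul hc, diff_mul hc, diff_mulOp, Dinv, diff_zpow, ← Dinv, zero_mul, zero_add,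
      h.hWb 1 le_rfl, ghostGenerator_one, e2, e1, h.db_one_Ψ j hj, mulOp_add, ← mulOp_mul_mulOp]
    noncomm_ring
  have := congrArg (fun A => A.coeff (-(l : ℤ))) h1
  simpa only [coeff_diff, coeff_add, coeff_mulOp_mul, primCoeff] using this

/-- w_l and the coefficients of D⁻¹Ψ_kW evolve along the ghost times as F and its primitives T_k do.
-/
theorem isEigenfunction_dualEigen {Lb : PDO (db 1)} (hLb : IsGhostLax dt db Φ Ψ Lb) (l : ℕ) :
    IsEigenfunction db Lb (dualEigen W Φ l) := fun s hs => by
  rw [← plusApply_plus, hLb.2 s hs]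
  exact h.ghostZS_plusApply_eq (fun s hs => h.db_coeff s hs _)
    (fun k hk => h.db_one_primCoeff k hk _) s hs

theorem dualIntegrand_succ (j : ℕ) : dualIntegrand (dt 1) Φ Ψ (j + 1) =
    iterRed (dt 1) (fun k => Ψ (k + 1)) (j + 1) 0 *
      Ring.inverse (iterRed (dt 1) (fun k => Ψ (k + 1)) j 0) := by
  rw [iterRed_zero_eq_wr h.hΨwr, iterRed_zero_eq_wr h.hΨwr, dualIntegrand, Ring.mul_inverse_rev,
    Ring.inverse_inverse (isUnit_wr h.hΨwr j), pow_two, Ring.mul_inverse_rev]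
  ring

theorem isIteratedPrimitive_dualEigen (l : ℕ) (hl : 2 ≤ l) :
    ∃ P, IsIteratedPrimitive (db 1) ((List.range (l - 1)).map (dualIntegrand (dt 1) Φ Ψ)) P ∧
      dualEigen W Φ l = (-1) ^ l * (Ring.inverse (Φ 1) * P) := by
  obtain ⟨m, rfl⟩ : ∃ m, l = m + 1 + 1 := ⟨l - 2, by omega⟩
  set f : ℕ → R := fun k => Ψ (k + 1)
  set T : ℕ → ℕ → R := fun l k => primCoeff W Ψ (k + 1) l
  set u : ℕ → R := fun l => W.coeff (-l)
  have hf := isUnit_iterRed h.hΨwr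
  have hflow : ShiftFlow (dt 1) (db 1) f (fun k => S 1 (k + 1)) (Φ 1) :=
    ⟨fun k => h.db_one_Ψ (k + 1) (by omega), fun k => h.hS 1 (k + 1) le_rfl (by omega)⟩
  have hT : ∀ l k, T (l + 1) k = u l * f k + -1 * dt 1 (T l k) := fun l k => by
    simp only [T, primCoeff_succ, f, u]; ring
  have hT0 : ∀ k, T 0 k = 0 := fun k => h.primCoeff_zero _
  have hu : u 0 = 1 := by simpa [u] using h.hW.1
  -- The outermost integral is ±w_{m+1}, with integrand Φ₁Ψ₁; the inner ones are the coefficients of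
  -- the elimination of the Ψ's with ε = -1. The signs make the innermost member 1.
  let Q : ℕ → R := fun j => Nat.casesOn j ((-1) ^ (m + 1 + 1) * u (m + 1)) fun j =>
    (-1) ^ (m + 1) * iterCoeff (dt 1) (-1) f T u (j + 1) (m + 1)
  have hQ0 : Q 0 = (-1) ^ (m + 1 + 1) * u (m + 1) := rfl
  have hQ : ∀ j, Q (j + 1) = (-1) ^ (m + 1) * iterCoeff (dt 1) (-1) f T u (j + 1) (m + 1) :=
    fun _ => rfl
  refine ⟨Q 0, isIteratedPrimitive_of_chain _ _ _ Q ?_ ?_, ?_⟩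
  · intro j _
    cases j with
    | zero =>
      rw [hQ0, hQ]
      simp only [dualIntegrand, iterCoeff, iterRedMod, iterRed, T, f, u]
      rw [Derivation.leibniz, h.db_one_coeff]
      simp only [Derivation.leibniz_pow, map_neg, Derivation.map_one_eq_zero, smul_eq_mul, neg_zero,
        smul_zero, mul_zero, add_zero, zero_add]
      linear_combination (-(-1) ^ (m + 1 + 1) * Φ 1 * primCoeff W Ψ 1 (m + 1)) *
        Ring.mul_inverse_cancel _ h.isUnit_Ψ
    | succ j =>
      have := hflow.derivation_iterCoeff (u := u) (T := T) (ε := -1)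
        (fun f => (h.htb 1 1 le_rfl le_rfl f).symm) (by simp) hf
        (fun l k => h.db_one_primCoeff (k + 1) (by omega) l) j (m + 1)
      rw [hQ, hQ, h.dualIntegrand_succ, Derivation.leibniz, this]
      simp only [Derivation.leibniz_pow, map_neg, Derivation.map_one_eq_zero, smul_eq_mul, neg_zero,
        smul_zero, mul_zero, add_zero]
      ring
  · have := iterCoeff_diag (u := u) hf hT hT0 (m + 1)
    rw [Nat.add_sub_cancel, hQ, this, hu, mul_one, ← mul_pow]
    simp
  · rw [hQ0, dualEigen, Nat.add_sub_cancel]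
    rw [mul_left_comm, ← mul_assoc ((-1) ^ _), ← mul_pow, neg_mul_neg, one_mul, one_pow, one_mul, mul_comm]

end

/-! ### The dual adjoint eigenfunctions -/

/-- The coefficient of `D⁰` in `D^{m-1} V F`. -/
noncomputable def kernelCoeff {d : Derivation ℤ R R} (V : PDO d) (F : R) (m : ℕ) : R :=
  (monomial ((m : ℤ) - 1) 1 * V * mulOp F).coeff 0

/-- The residue of `D^{m-1} V`. -/
noncomputable def kernelRes {d : Derivation ℤ R R} (V : PDO d) (m : ℕ) : R :=
  (monomial ((m : ℤ) - 1) 1 * V).coeff (-1)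

section kernel
variable {d : Derivation ℤ R R} {V : PDO d}

/-- Left multiplication by D differentiates the D⁰ coefficient and adds the residue, in which F
comes out as a factor. -/
theorem kernelCoeff_succ (F : R) (m : ℕ) :
    kernelCoeff V F (m + 1) = kernelRes V m * F + d (kernelCoeff V F m) := by
  have h1 : (monomial (((m + 1 : ℕ) : ℤ) - 1) 1 * V * mulOp F) =
      D * (monomial ((m : ℤ) - 1) 1 * V * mulOp F) := by
    rw [D, ← mul_assoc, ← mul_assoc, zpow_mul_zpow]
    congr 3
    push_cast; ring
  rw [kernelCoeff, h1, coeff_D_mul, zero_sub, res_mul_mulOp, add_comm]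
  rfl

theorem kernelCoeff_zero (hV : IsDressingForm V) (F : R) : kernelCoeff V F 0 = 0 :=
  ((orderLE_monomial _ _).mul hV.orderLE).mul (orderLE_mulOp F) _ (by simp)

theorem kernelRes_zero (hV : IsDressingForm V) : kernelRes V 0 = 1 := by
  have := coeff_mul_top (orderLE_monomial (-1) (1 : R)) hV.orderLE
  rw [add_zero, hV.1, coeff_monomial, if_pos rfl, mul_one] at this
  simpa [kernelRes] using this

theorem kernelCoeff_one (hV : IsDressingForm V) (F : R) : kernelCoeff V F 1 = F := by
  have := kernelCoeff_succ (V := V) F 0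
  rw [zero_add, kernelCoeff_zero hV, kernelRes_zero hV, map_zero, one_mul, add_zero] at this
  exact this

theorem kernelCoeff_neg (F : R) (m : ℕ) : kernelCoeff V (-F) m = -kernelCoeff V F m := by
  simp only [kernelCoeff, mulOp_neg, mul_neg, coeff_neg]

end kernel

/-- `Y_{i+1}(F) - (F/Φ₁) Y_{i+1}(Φ₁)`, a primitive of `Ψ̄_i F/Φ₁` with respect to `t̄₁`. -/
noncomputable def dualPrim {d : Derivation ℤ R R} (V : PDO d) (Φ : ℕ → R) (F : R) (i : ℕ) : R :=
  kernelCoeff V F (i + 1) - F * Ring.inverse (Φ 1) * kernelCoeff V (Φ 1) (i + 1)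

/-- The functions `Ψ̄_i`. -/
noncomputable def dualAdj {d : Derivation ℤ R R} (V : PDO d) (Φ : ℕ → R) (i : ℕ) : R :=
  dualPrim V Φ (Φ 2) i

section
variable (h : GhostSystem dt db W L Φ Ψ S) {V : PDO (dt 1)} (hV : IsDressingForm V)
  (hWV : W * V = 1) (hVW : V * W = 1)
include h

include hWV in
theorem L_pow_eq (r : ℕ) : L ^ r = W * (monomial r 1 * V) := by
  rw [← mul_assoc, ← D_pow, ← pow_mul_dressing h.hL, mul_assoc, hWV, mul_one]

include hWV hV in
/-- `(Lʳ)₊(F) = ∑_l w_l Y_{r-l+1}(F)`. -/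
theorem L_pow_plusApply (r : ℕ) (F : R) : (L ^ r).plusApply F =
    ∑ l ∈ Finset.range (r + 1), W.coeff (-l) * kernelCoeff V F (r - l + 1) := by
  have hB : (monomial r 1 * V * mulOp F).OrderLE r := by
    simpa using ((orderLE_monomial (r : ℤ) (1 : R)).mul hV.orderLE).mul (orderLE_mulOp F)
  rw [plusApply_eq_coeff, h.L_pow_eq hWV, mul_assoc,
    coeff_mul_eq_sum h.hW.orderLE hB 0 (a := -r) (by omega)]
  symm
  refine Finset.sum_bij (fun i _ => -(i : ℤ)) ?_ ?_ ?_ ?_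
  · intro i hi; rw [Finset.mem_range] at hi; rw [Finset.mem_Icc]; omega
  · intro i _ j _ hij; simpa using hij
  · intro i hi
    rw [Finset.mem_Icc] at hi
    exact ⟨(-i).toNat, Finset.mem_range.2 (by omega), by omega⟩
  · intro i hi
    rw [Finset.mem_range] at hi
    have := coeff_zpow_mul (-(i : ℤ)) 0 1 (monomial r 1 * V * mulOp F)
    rw [one_mul] at this
    rw [← this, ← mul_assoc, ← mul_assoc, zpow_mul_zpow, kernelCoeff]
    congr 5
    omega

include hWV hV in
-- The term w_r Y₁(F) = w_r F of (Lʳ)₊(F) drops out of the combination of F with Φ₁; this leaves the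
-- indices i ≥ 1.
theorem sum_dualPrim (r : ℕ) (F : R) :
    ∑ i ∈ Finset.Icc 1 r, dualEigen W Φ (r - i + 1) * dualPrim V Φ F i =
      Ring.inverse (Φ 1) * ((L ^ r).plusApply F -
        F * Ring.inverse (Φ 1) * (L ^ r).plusApply (Φ 1)) := by
  have hv := h.mul_inv
  have key : ∀ G, ∑ i ∈ Finset.Icc 1 r, W.coeff (-(r - i : ℕ)) * kernelCoeff V G (i + 1) =
      (L ^ r).plusApply G - W.coeff (-r) * G := fun G => by
    rw [h.L_pow_plusApply hV hWV, Finset.sum_range_succ, Nat.sub_self, zero_add, kernelCoeff_one hV,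
      add_sub_cancel_right, sum_Icc_one, ← Finset.sum_range_reflect]
    refine Finset.sum_congr rfl fun i hi => ?_
    rw [Finset.mem_range] at hi
    rw [show r - (r - 1 - i + 1) = i by omega, show r - 1 - i + 1 + 1 = r - i + 1 by omega]
  have e : ∑ i ∈ Finset.Icc 1 r, dualEigen W Φ (r - i + 1) * dualPrim V Φ F i =
      Ring.inverse (Φ 1) * (∑ i ∈ Finset.Icc 1 r, W.coeff (-(r - i : ℕ)) * kernelCoeff V F (i + 1)) -
      Ring.inverse (Φ 1) * (F * Ring.inverse (Φ 1)) *
        (∑ i ∈ Finset.Icc 1 r, W.coeff (-(r - i : ℕ)) * kernelCoeff V (Φ 1) (i + 1)) := by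
    rw [Finset.mul_sum, Finset.mul_sum, ← Finset.sum_sub_distrib]
    refine Finset.sum_congr rfl fun i _ => ?_
    rw [dualEigen, dualPrim, Nat.add_sub_cancel]
    ring
  rw [e, key, key]
  linear_combination (Ring.inverse (Φ 1) * F * W.coeff (-r)) * hv

include hWV hV in
/-- The evolution of `F/Φ₁` for an eigenfunction `F` of `L`. -/
theorem dt_div (F : R) (r : ℕ) (hr : 1 ≤ r) (hF : dt r F = (L ^ r).plusApply F) :
    dt r (F * Ring.inverse (Φ 1)) =
      ∑ i ∈ Finset.Icc 1 r, dualEigen W Φ (r - i + 1) * dualPrim V Φ F i := by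
  rw [h.sum_dualPrim hV hWV, ← hF, ← h.hΦ 1 le_rfl r hr, Derivation.leibniz,
    derivation_inverse _ h.isUnit_Φ, smul_eq_mul, smul_eq_mul]
  ring

include hWV hVW in
theorem diff_inverse : V.diff (db 1) = -(V * ghostGenerator (dt 1) Φ Ψ 1) := by
  have hc : ∀ f, db 1 (dt 1 f) = dt 1 (db 1 f) := fun f => (h.htb 1 1 le_rfl le_rfl f).symm
  have h1 := congrArg (PDO.diff (db 1)) hVW
  rw [diff_mul hc, h.hWb 1 le_rfl, diff_one, ← mul_assoc, ← add_mul] at h1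
  have h2 := congrArg (· * V) h1
  simp only [mul_assoc, hWV, mul_one, zero_mul] at h2
  rw [eq_neg_iff_add_eq_zero, h2]

include hWV hVW in
-- W⁻¹ evolves by -W⁻¹Φ₁D⁻¹Ψ₁. Since Ψ₁F = ∂T, integration by parts gives Φ₁D⁻¹Ψ₁F = Φ₁T - Φ₁D⁻¹T D;
-- the first term cancels against ∂̄F, and the second contributes Y_m(Φ₁) T through a residue.
theorem db_one_kernelCoeff {F T G : R} (hF : db 1 F = Φ 1 * T + G) (hT : dt 1 T = Ψ 1 * F)
    (m : ℕ) : db 1 (kernelCoeff V F m) = kernelCoeff V (Φ 1) m * T + kernelCoeff V G m := by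
  have hc : ∀ f, db 1 (dt 1 f) = dt 1 (db 1 f) := fun f => (h.htb 1 1 le_rfl le_rfl f).symm
  set Z : PDO (dt 1) := monomial ((m : ℤ) - 1) 1 * V
  have e1 : (ghostGenerator (dt 1) Φ Ψ 1) * mulOp F =
      mulOp (Φ 1 * T) - mulOp (Φ 1) * Dinv * mulOp T * D := by
    rw [ghostGenerator_one, mul_assoc, mulOp_mul_mulOp, ← hT, mul_assoc, Dinv_mul_mulOp_deriv,
      mul_sub, mulOp_mul_mulOp]
    simp only [mul_assoc]
  have e2 : (Z * mulOp F).diff (db 1) =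
      Z * mulOp (Φ 1) * Dinv * mulOp T * D + Z * mulOp G := by
    rw [diff_mul hc, diff_mul hc, diff_zpow, zero_mul, zero_add, h.diff_inverse hWV hVW, diff_mulOp,
      hF, mul_neg, neg_mul, mul_assoc, mul_assoc V, e1, mulOp_add]
    simp only [Z]
    noncomm_ring
  have e3 := congrArg (fun A => A.coeff 0) e2
  simp only [coeff_diff, coeff_add] at e3
  rw [coeff_mul_D, zero_sub, res_mul_mulOp, coeff_mul_Dinv] at e3
  exact e3

include hWV hVW in
/-- `∂(Y_{i+1}(F) - (F/Φ₁) Y_{i+1}(Φ₁))/∂t̄₁`. -/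
theorem db_one_dualPrim {F T G : R} (hF : db 1 F = Φ 1 * T + G) (hT : dt 1 T = Ψ 1 * F) (i : ℕ) :
    db 1 (dualPrim V Φ F i) =
      dualAdj V Φ i * (F * Ring.inverse (Φ 1)) + dualPrim V Φ G i := by
  have hΦ1 : db 1 (Φ 1) = Φ 1 * S 1 1 + -Φ 2 := by rw [h.db_one_Φ 1 le_rfl, sub_eq_add_neg]
  have h1 := h.db_one_kernelCoeff hWV hVW hF hT (i + 1)
  have h2 := h.db_one_kernelCoeff hWV hVW hΦ1
    (by rw [h.hS 1 1 le_rfl le_rfl, mul_comm]) (i + 1)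
  rw [kernelCoeff_neg] at h2
  simp only [dualPrim, dualAdj, map_sub, Derivation.leibniz, h1, h2, hF, smul_eq_mul,
    derivation_inverse _ h.isUnit_Φ, hΦ1]
  linear_combination (-kernelCoeff V (Φ 1) (i + 1) * T +
    F * Ring.inverse (Φ 1) * kernelCoeff V (Φ 1) (i + 1) * S 1 1) * h.mul_inv

include hWV hVW in
theorem db_one_dualPrim_Φ (k : ℕ) (hk : 1 ≤ k) (i : ℕ) :
    db 1 (dualPrim V Φ (Φ k) i) =
      dualAdj V Φ i * (Φ k * Ring.inverse (Φ 1)) - dualPrim V Φ (Φ (k + 1)) i := by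
  have := h.db_one_dualPrim hWV hVW (F := Φ k) (T := S k 1) (G := -Φ (k + 1))
    (by rw [h.db_one_Φ k hk, sub_eq_add_neg]) (by rw [h.hS k 1 hk le_rfl, mul_comm]) i
  rw [this, dualPrim, dualPrim, kernelCoeff_neg]
  ring

theorem adjDualIntegrand_eq (j : ℕ) : adjDualIntegrand (dt 1) Φ j =
    iterRed (dt 1) (fun k => Φ (k + 1)) (j + 2) 0 *
      Ring.inverse (iterRed (dt 1) (fun k => Φ (k + 1)) (j + 1) 0) := by
  rw [iterRed_zero_eq_wr h.hΦwr, iterRed_zero_eq_wr h.hΦwr, adjDualIntegrand, Ring.mul_inverse_rev,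
    Ring.inverse_inverse (isUnit_wr h.hΦwr (j + 1)), pow_two, Ring.mul_inverse_rev]
  ring

include hV hWV hVW in
theorem isIteratedPrimitive_dualAdj (j : ℕ) (hj : 1 ≤ j) :
    ∃ P, IsIteratedPrimitive (db 1) ((List.range (j - 1)).map (adjDualIntegrand (dt 1) Φ)) P ∧
      dualAdj V Φ j = (-1) ^ (j - 1) * (wr (dt 1) Φ 2 * Ring.inverse (Φ 1) * P) := by
  obtain ⟨m, rfl⟩ : ∃ m, j = m + 1 := ⟨j - 1, by omega⟩
  set f : ℕ → R := fun k => Φ (k + 1)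
  set T : ℕ → ℕ → R := fun l k => kernelCoeff V (Φ (k + 1)) l
  set u : ℕ → R := kernelRes V
  have hf := isUnit_iterRed h.hΦwr
  -- The Φ_k are shifted by -∂̄, hence the alternating signs in `Q`.
  have hflow : ShiftFlow (dt 1) (-db 1) f (fun k => -S (k + 1) 1) (-Ψ 1) := by
    refine ⟨fun k => ?_, fun k => ?_⟩
    · simp only [f]
      rw [Derivation.neg_apply, h.db_one_Φ (k + 1) (by omega)]
      ring
    · rw [map_neg, h.hS (k + 1) 1 (by omega) le_rfl]
      ring
  have hT : ∀ l k, T (l + 1) k = u l * f k + 1 * dt 1 (T l k) := fun l k => by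
    simp only [T, kernelCoeff_succ, f, u]; ring
  have hT0 : ∀ k, T 0 k = 0 := fun k => kernelCoeff_zero hV _
  have hu : u 0 = 1 := kernelRes_zero hV
  have hTb : ∀ l k, (-db 1) (T l k) = T l (k + 1) + -S (k + 1) 1 * T l 0 := fun l k => by
    simp only [T]
    rw [Derivation.neg_apply, h.db_one_kernelCoeff hWV hVW (F := Φ (k + 1)) (T := S (k + 1) 1)
      (G := -Φ (k + 2)) (by rw [h.db_one_Φ (k + 1) (by omega), sub_eq_add_neg])
      (by rw [h.hS (k + 1) 1 (by omega) le_rfl, mul_comm]), kernelCoeff_neg]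
    ring
  -- The chain starts at the second reduction: Ψ̄_{m+1} is itself a once-reduced quantity, equal to
  -- q₁ = W₂/Φ₁ times the coefficient produced at that stage.
  let Q : ℕ → R := fun i => (-1) ^ (m + i) * iterCoeff (dt 1) 1 f T u (i + 2) (m + 2)
  refine ⟨Q 0, isIteratedPrimitive_of_chain _ _ _ Q ?_ ?_, ?_⟩
  · intro i _
    have := hflow.derivation_iterCoeff (u := u) (T := T) (ε := 1)
      (fun f => by simp [h.htb 1 1 le_rfl le_rfl f]) (by simp) hf hTb (i + 1) (m + 2)
    rw [Derivation.neg_apply, neg_eq_iff_eq_neg] at this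
    simp only [Q]
    rw [h.adjDualIntegrand_eq, Derivation.leibniz, this]
    simp only [Derivation.leibniz_pow, map_neg, Derivation.map_one_eq_zero, smul_eq_mul, neg_zero,
      smul_zero, mul_zero, add_zero]
    ring
  · have := iterCoeff_diag (u := u) hf hT hT0 (m + 2)
    simp only [Q, Nat.add_sub_cancel]
    rw [this, hu, ← two_mul]
    simp
  · have hq : iterRed (dt 1) f 1 0 = wr (dt 1) Φ 2 * Ring.inverse (Φ 1) := by
      rw [iterRed_zero_eq_wr h.hΦwr, wr_one]
    have hq1 := Ring.mul_inverse_cancel _ (hf 1)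
    have hdual : dualAdj V Φ (m + 1) = iterRedMod (dt 1) f (T (m + 2)) 1 0 := rfl
    simp only [Q, Nat.add_sub_cancel, add_zero]
    rw [← hq, mul_left_comm, ← mul_assoc ((-1) ^ m), ← mul_pow, hdual, iterCoeff]
    simp only [neg_mul_neg, one_mul, one_pow]
    linear_combination (-iterRedMod (dt 1) f (T (m + 2)) 1 0) * hq1

include hV hWV hVW in
theorem isDualSystem : IsDualSystem (dt 1) (db 1) Φ Ψ (dualEigen W Φ) (dualAdj V Φ) :=
  ⟨h.dualEigen_one, h.isIteratedPrimitive_dualEigen, h.isIteratedPrimitive_dualAdj hV hWV hVW⟩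

include hV hWV hVW in
/-- `∂W̄/∂t_r = 𝓜̄_r W̄`. -/
theorem diff_ghostDressing (r : ℕ) (hr : 1 ≤ r) : (ghostDressing (db 1) Φ).diff (dt r) =
    ghostGenerator (db 1) (dualEigen W Φ) (dualAdj V Φ) r * ghostDressing (db 1) Φ := by
  set Wb := ghostDressing (db 1) Φ
  let A : ℕ → PDO (db 1) := fun i =>
    PDO.mk (fun n => if 0 < n then 0 else dualPrim V Φ (Φ ((-n).toNat + 1)) i)
      ⟨0, fun _ hn => if_pos hn⟩
  have hA : ∀ i (l : ℕ), (A i).coeff (-l) = dualPrim V Φ (Φ (l + 1)) i := fun i l => by simp [A]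
  have hA' : ∀ i n, 0 < n → (A i).coeff n = 0 := fun i n hn => if_pos hn
  -- It suffices to compare after applying D̄. The D̄⁰ coefficient of `A i` vanishes, being the
  -- bracket for F = Φ₁, and the index shift cancels the term with Φ_{k+1}.
  have hDA : ∀ i, Dinv * mulOp (dualAdj V Φ i) * Wb = A i := fun i => by
    apply D_mul_injective
    rw [← mul_assoc, ← mul_assoc, D_mul_Dinv, one_mul]
    refine ext_coeff fun n => ?_
    rw [coeff_mulOp_mul, coeff_D_mul]
    rcases exists_eq_neg_or_pos n with ⟨l, rfl⟩ | ⟨l, rfl⟩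
    · rw [show -(l : ℤ) - 1 = -(l + 1 : ℕ) by push_cast; ring, hA, hA, coeff_ghostDressing_neg,
        h.db_one_dualPrim_Φ hWV hVW _ (by omega)]
      ring
    · rw [orderLE_ghostDressing _ _ _ (by omega), hA' _ _ (by omega), add_sub_cancel_right, map_zero,
        mul_zero, zero_add]
      cases l with
      | zero =>
        have h0 := hA i 0
        simp only [Nat.cast_zero, neg_zero, zero_add] at h0 ⊢
        rw [h0, dualPrim, h.mul_inv, one_mul, sub_self]
      | succ l => rw [hA' _ _ (by omega)]
  rw [ghostGenerator_mul]
  refine ext_coeff fun n => ?_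
  simp only [coeff_sum, hDA, coeff_mulOp_mul, coeff_diff]
  rcases exists_eq_neg_or_pos n with ⟨l, rfl⟩ | ⟨l, rfl⟩
  · simp only [hA]
    rw [coeff_ghostDressing_neg, h.dt_div hV hWV _ r hr (h.hΦ (l + 1) (by omega) r hr)]
  · simp only [hA' _ _ (show 0 < (l : ℤ) + 1 by omega), mul_zero, Finset.sum_const_zero]
    rw [orderLE_ghostDressing _ _ _ (by omega), map_zero]

include hV hWV hVW in
-- Cross-differentiating W̄ gives the zero curvature equation for 𝓜̄_r and A = M̄_s. In its residue
-- ∂A/∂t_r disappears, and the eigenfunction equations of the Φ̄'s leave ∑ Φ̄_{r-i+1} (∂Ψ̄_i/∂t̄_s +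
-- A*(Ψ̄_i)) = 0. The system is triangular in r with the unit Φ̄₁ on the diagonal.
theorem isAdjEigenfunction_dualAdj {Vb Lb : PDO (db 1)} (hWVb : ghostDressing (db 1) Φ * Vb = 1)
    (hLb : IsGhostLax dt db Φ Ψ Lb) (i : ℕ) (hi : 1 ≤ i) :
    IsAdjEigenfunction db Lb (dualAdj V Φ i) := by
  intro s hs
  set Wb := ghostDressing (db 1) Φ
  set A := ghostZS dt db Φ Ψ s
  set P := dualEigen W Φ
  set Q := dualAdj V Φ
  set M : ℕ → PDO (db 1) := ghostGenerator (db 1) P Q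
  have hAd : A.IsDifferential := isDifferential_ghostZS _ _ _ _ _
  have hres : ∀ i, (Lb.adjoint ^ s).plusApply (Q i) = (Dinv * mulOp (Q i) * A).coeff (-1) := by
    intro i
    rw [plusApply_adjoint_pow, ← plus_add_minus (Lb ^ s), hLb.2 s hs, mul_add, coeff_add,
      orderLE_Dinv_mul (orderLE_minus _) _ _ (by omega), add_zero]
  have hcomm : ∀ r, 1 ≤ r → (M r).diff (db s) + M r * A = A.diff (dt r) + A * M r := by
    intro r hr
    have e1 : Wb.diff (db s) = A * Wb - Wb * D ^ s := by
      rw [h.ghostZS_mul_ghostDressing s hs, add_sub_cancel_right]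
    have e2 : Wb.diff (dt r) = M r * Wb := h.diff_ghostDressing hV hWV hVW r hr
    have e3 : (Wb.diff (dt r)).diff (db s) = (Wb.diff (db s)).diff (dt r) :=
      ext_coeff fun n => (h.htb r s hr hs _).symm
    rw [e1, e2, diff_mul (fun f => h.hbb s 1 hs le_rfl f), diff_sub,
      diff_mul (fun f => h.htb r 1 hr le_rfl f), diff_mul (fun f => h.htb r 1 hr le_rfl f), D_pow,
      diff_zpow, mul_zero, add_zero, ← D_pow, e1, e2] at e3
    have e4 : ((M r).diff (db s) + M r * A) * Wb = (A.diff (dt r) + A * M r) * Wb := by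
      rw [add_mul, add_mul, mul_assoc, mul_assoc]
      rw [mul_sub] at e3
      calc _ = (M r).diff (db s) * Wb + (M r * (A * Wb) - M r * (Wb * D ^ s)) +
            M r * (Wb * D ^ s) := by abel
        _ = _ := by rw [e3, mul_assoc (M r)]; abel
    calc _ = ((M r).diff (db s) + M r * A) * Wb * Vb := by rw [mul_assoc, hWVb, mul_one]
      _ = _ := by rw [e4, mul_assoc, hWVb, mul_one]
  have hsum : ∀ r, 1 ≤ r → ∑ i ∈ Finset.Icc 1 r,
      P (r - i + 1) * (db s (Q i) + (Dinv * mulOp (Q i) * A).coeff (-1)) = 0 := by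
    intro r hr
    have e1 := congrArg (fun B => B.coeff (-1)) (hcomm r hr)
    simp only [coeff_add, coeff_diff] at e1
    rw [hAd _ (by omega), map_zero, zero_add, ghostGenerator_mul] at e1
    simp only [M, ghostGenerator, Finset.mul_sum, coeff_sum, map_sum] at e1
    simp only [← mul_assoc A, res_mul_mulOp, coeff_mul_Dinv, coeff_mulOp_mul] at e1
    rw [← Finset.sum_add_distrib, ← sub_eq_zero, ← Finset.sum_sub_distrib] at e1
    rw [← e1]
    refine Finset.sum_congr rfl fun i _ => ?_
    have e2 : db s (P (r - i + 1)) = (A * mulOp (P (r - i + 1))).coeff 0 := by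
      rw [h.isEigenfunction_dualEigen hLb _ s hs, ← plusApply_plus, hLb.2 s hs, plusApply_eq_coeff]
    have e3 : (mulOp (P (r - i + 1)) : PDO (db 1)).coeff (-1 + 1) = P (r - i + 1) := by
      simp [coeff_mulOp]
    rw [e3, show (-1 : ℤ) + 1 = 0 by norm_num, ← e2, Derivation.leibniz, smul_eq_mul, smul_eq_mul]
    ring
  have hP : IsUnit (P 1) := by
    simpa only [P, h.dualEigen_one] using h.isUnit_Φ.ringInverse
  rw [hres, eq_neg_iff_add_eq_zero]
  exact eq_zero_of_conv hP hsum i hi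

end

section
variable (h : GhostSystem dt db W L Φ Ψ S)
include h

/-! ### The Lax equations -/

theorem lax_dt {V : PDO (dt 1)} (hWV : W * V = 1) (r : ℕ) (hr : 1 ≤ r) :
    L.diff (dt r) = comm (L ^ r).plus L := by
  rw [diff_lax (fun f => h.htt r 1 hr le_rfl f) hWV h.hL
    (X := -(L ^ r).minus) (by rw [h.hWt r hr, neg_mul])]
  have e : -(L ^ r).minus = (L ^ r).plus - L ^ r := by
    rw [eq_sub_iff_add_eq, neg_add_eq_iff_eq_add, add_comm, plus_add_minus]
  rw [e, PDO.comm, PDO.comm, sub_mul, mul_sub, ← pow_succ, ← pow_succ']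
  abel

theorem lax_db {V : PDO (dt 1)} (hWV : W * V = 1) (s : ℕ) (hs : 1 ≤ s) :
    L.diff (db s) = comm (ghostGenerator (dt 1) Φ Ψ s) L :=
  diff_lax (fun f => (h.htb 1 s le_rfl hs f).symm) hWV h.hL (h.hWb s hs)

theorem ghostLax_db {Vb Lb : PDO (db 1)} (hWVb : ghostDressing (db 1) Φ * Vb = 1)
    (hLb : IsGhostLax dt db Φ Ψ Lb)
    (hLW : Lb * ghostDressing (db 1) Φ = ghostDressing (db 1) Φ * D) (s : ℕ) (hs : 1 ≤ s) :
    Lb.diff (db s) = comm (Lb ^ s).plus Lb := by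
  rw [diff_lax (fun f => h.hbb s 1 hs le_rfl f) hWVb hLW (X := (Lb ^ s).plus - Lb ^ s) (by
    rw [sub_mul, pow_mul_dressing hLW, hLb.2 s hs, h.ghostZS_mul_ghostDressing s hs,
      add_sub_cancel_right]), PDO.comm, PDO.comm, sub_mul, mul_sub, ← pow_succ, ← pow_succ']
  abel

/-! ### Generic eigenfunctions -/

/-- The brackets `dualPrim V Φ F i` serve as the primitives of Ψ̄_i F/Φ₁. -/
theorem isGeneric_div {V : PDO (dt 1)} (hV : IsDressingForm V) (hWV : W * V = 1) (hVW : V * W = 1)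
    {Lb : PDO (db 1)} (hLb : IsGhostLax dt db Φ Ψ Lb) {F : R}
    (hF : IsGenericEigenfunction dt db L Φ Ψ F) :
    IsGenericEigenfunction db dt Lb (dualEigen W Φ) (dualAdj V Φ) (F * Ring.inverse (Φ 1)) := by
  obtain ⟨hF1, T, hT, hFs⟩ := hF
  refine ⟨fun s hs => ?_, dualPrim V Φ F, fun j _ => ?_, fun r hr => h.dt_div hV hWV F r hr
    (hF1 r hr)⟩
  · rw [← plusApply_plus, hLb.2 s hs]
    refine h.ghostZS_plusApply_eq hFs (fun k hk => ?_) s hs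
    -- A single function is treated as the sequence F, 0, 0, …, for which the shifted term F_{k+s}
    -- vanishes.
    have := h.db_one_primitive (F := fun k => if k = 1 then F else 0)
      (T := fun k j => if k = 1 then T j else 0)
      (fun k j _ hj => by split_ifs <;> simp [hT j hj])
      (fun s k hs hk => by
        rw [if_neg (show k + s ≠ 1 by omega), sub_zero]
        split_ifs
        · exact hFs s hs
        · simp) 1 k le_rfl hk
    simpa using this
  · have := h.db_one_dualPrim hWV hVW (F := F) (T := T 1) (G := 0) (by rw [hFs 1 le_rfl]; simp)
      (hT 1 le_rfl) j
    rw [this]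
    simp [dualPrim, kernelCoeff, mulOp_zero]

theorem L_plusApply {V : PDO (dt 1)} (hV : IsDressingForm V) (hWV : W * V = 1) (hVW : V * W = 1)
    (F : R) : (L ^ 1).plusApply F = dt 1 F := by
  have hL : L = W * D * V := by rw [← h.hL, mul_assoc, hWV, mul_one]
  have hlax : IsLaxForm L := hL ▸ isLaxForm_of_dressing h.hW hV hVW
  have hp : L.plus = D * mulOp 1 := by
    rw [mulOp_one, mul_one]
    refine ext_coeff fun n => ?_
    rw [plus, coeff_mk, D, coeff_monomial]
    split_ifs with h1 h2 h2
    · rw [h2, hlax.1]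
    · rcases eq_or_lt_of_le h1 with h3 | h3
      · rw [← h3, hlax.2.1]
      · exact hlax.2.2 n (by omega)
    · omega
    · rfl
  rw [pow_one, ← plusApply_plus, hp, plusApply_D_mul (isDifferential_mulOp 1), plusApply_mulOp,
    one_mul]

theorem dt_Ψ_one {V : PDO (dt 1)} (hV : IsDressingForm V) (hWV : W * V = 1) (r : ℕ) (hr : 1 ≤ r) :
    dt r (Ψ 1) =
      -∑ l ∈ Finset.range (r + 2), primCoeff W Ψ 1 l * kernelRes V (r + 1 - l) := by
  have hB : (monomial r 1 * V).OrderLE r := by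
    simpa using (orderLE_monomial (r : ℤ) (1 : R)).mul hV.orderLE
  have hA : (Dinv * mulOp (Ψ 1) * W).OrderLE 0 :=
    (orderLE_Dinv_mul h.hW.orderLE _).mono (by omega)
  rw [h.hΨ 1 le_rfl r hr, plusApply_adjoint_pow, h.L_pow_eq hWV, ← mul_assoc,
    coeff_mul_eq_sum hA hB (-1) (a := -(r + 1)) (by omega)]
  congr 1
  symm
  refine Finset.sum_bij (fun i _ => -(i : ℤ)) ?_ ?_ ?_ ?_
  · intro i hi; rw [Finset.mem_range] at hi; rw [Finset.mem_Icc]; omega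
  · intro i _ j _ hij; simpa using hij
  · intro i hi
    rw [Finset.mem_Icc] at hi
    exact ⟨(-i).toNat, Finset.mem_range.2 (by omega), by omega⟩
  · intro i hi
    rw [Finset.mem_range] at hi
    have := coeff_zpow_mul (-(i : ℤ)) (-1) 1 (monomial r 1 * V)
    rw [one_mul] at this
    rw [← this, ← mul_assoc, zpow_mul_zpow, kernelRes, primCoeff]
    congr 4
    omega

/-- If `F` solves `∂(Φ₁⁻¹ ∂F/∂t̄₁) = Ψ₁ F`, then so does `∂F/∂t_r - (Lʳ)₊(F)`. -/
theorem defect_equation {V : PDO (dt 1)} (hV : IsDressingForm V) (hWV : W * V = 1)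
    (hVW : V * W = 1) {F T : R} (hF : db 1 F = Φ 1 * T) (hT : dt 1 T = Ψ 1 * F) (r : ℕ)
    (hr : 1 ≤ r) :
    dt 1 (Ring.inverse (Φ 1) * db 1 (dt r F - (L ^ r).plusApply F)) =
      Ψ 1 * (dt r F - (L ^ r).plusApply F) := by
  set Y := kernelCoeff V F
  set y := kernelCoeff V (Φ 1)
  set t := primCoeff W Ψ 1
  -- `Q` is what ∂T/∂t_r must be if F satisfies its eigenfunction equation.
  set Q : R := ∑ l ∈ Finset.range (r + 1), t l * Y (r - l + 1)
  have hY : ∀ m, db 1 (Y m) = y m * T := fun m => by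
    have := h.db_one_kernelCoeff hWV hVW (G := 0) (by rw [hF, add_zero]) hT m
    rw [this]
    simp [kernelCoeff, mulOp_zero, y]
  have hL : (L ^ r).plusApply F =
      ∑ l ∈ Finset.range (r + 1), W.coeff (-l) * Y (r - l + 1) := h.L_pow_plusApply hV hWV r F
  have h1 : db 1 ((L ^ r).plusApply F) = Φ 1 * Q + T * dt r (Φ 1) := by
    rw [h.hΦ 1 le_rfl r hr, hL, h.L_pow_plusApply hV hWV r (Φ 1), map_sum, Finset.mul_sum,
      Finset.mul_sum, ← Finset.sum_add_distrib]
    refine Finset.sum_congr rfl fun l _ => ?_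
    rw [Derivation.leibniz, hY, h.db_one_coeff, smul_eq_mul, smul_eq_mul]
    ring
  -- The two sums left by the product rule differ by an index shift. Their boundary term t_{r+1}F
  -- supplies the last summand of ∂Ψ₁/∂t_r in `dt_Ψ_one`.
  have h2 : dt 1 Q = Ψ 1 * (L ^ r).plusApply F + F * dt r (Ψ 1) := by
    have e1 : dt 1 Q = Ψ 1 * (L ^ r).plusApply F -
        ∑ l ∈ Finset.range (r + 1), t (l + 1) * Y (r - l + 1) +
        ∑ l ∈ Finset.range (r + 1), t l * Y (r + 2 - l) -
        F * ∑ l ∈ Finset.range (r + 1), t l * kernelRes V (r + 1 - l) := by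
      rw [hL, map_sum, Finset.mul_sum, Finset.mul_sum, ← Finset.sum_sub_distrib,
        ← Finset.sum_add_distrib, ← Finset.sum_sub_distrib]
      refine Finset.sum_congr rfl fun l hl => ?_
      rw [Finset.mem_range] at hl
      have a1 := kernelCoeff_succ (V := V) F (r - l + 1)
      have a2 := primCoeff_succ W Ψ 1 l
      rw [show r - l + 1 + 1 = r + 2 - l by omega, show r - l + 1 = r + 1 - l by omega] at a1
      rw [Derivation.leibniz, smul_eq_mul, smul_eq_mul]
      simp only [t, Y]
      rw [a1, a2, show r - l + 1 = r + 1 - l by omega]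
      ring
    have e2 := Finset.sum_range_succ (fun l => t l * Y (r + 2 - l)) (r + 1)
    have e3 := Finset.sum_range_succ' (fun l => t l * Y (r + 2 - l)) (r + 1)
    have e4 : t 0 = 0 := h.primCoeff_zero 1
    have e5 : Y 1 = F := kernelCoeff_one hV F
    have e6 := h.dt_Ψ_one hV hWV r hr
    have e7 : ∀ l ∈ Finset.range (r + 1), t (l + 1) * Y (r + 2 - (l + 1)) =
        t (l + 1) * Y (r - l + 1) := fun l hl => by
      rw [Finset.mem_range] at hl
      rw [show r + 2 - (l + 1) = r - l + 1 by omega]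
    rw [Finset.sum_range_succ, Nat.sub_self, kernelRes_zero hV] at e6
    simp only [show r + 2 - (r + 1) = 1 by omega] at e2
    rw [Finset.sum_congr rfl e7, e4, zero_mul, add_zero] at e3
    rw [e5] at e2
    rw [e1, e6]
    linear_combination e3 - e2
  have h3 : db 1 (dt r F) = Φ 1 * dt r T + T * dt r (Φ 1) := by
    rw [← h.htb r 1 hr le_rfl, hF, Derivation.leibniz, smul_eq_mul, smul_eq_mul]
  have h4 : Ring.inverse (Φ 1) * db 1 (dt r F - (L ^ r).plusApply F) = dt r T - Q := by
    rw [map_sub, h1, h3]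
    linear_combination (dt r T - Q) * h.mul_inv
  rw [h4, map_sub, h2, h.htt 1 r le_rfl hr, hT, Derivation.leibniz, smul_eq_mul, smul_eq_mul]
  ring

/-- The t̄-evolution leaves no choice for the primitives: T₁ = ∂̄F/Φ₁ and T_{k+1} = ∂̄T_k -
S_{1k}T₁. That they are primitives of Ψ_k F follows from the single equation r = 1. The remaining
t_r-equations have defects ∑ w_{r-i}E_i, which the hyperbolic equation ∂(Φ₁⁻¹∂̄F) = Ψ₁F forces to
vanish. -/
theorem isGeneric_mul {V : PDO (dt 1)} (hV : IsDressingForm V) (hWV : W * V = 1) (hVW : V * W = 1)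
    {Lb : PDO (db 1)} (hLb : IsGhostLax dt db Φ Ψ Lb) {Fb : R}
    (hFb : IsGenericEigenfunction db dt Lb (dualEigen W Φ) (dualAdj V Φ) Fb) :
    IsGenericEigenfunction dt db L Φ Ψ (Φ 1 * Fb) := by
  obtain ⟨hFb1, Tb, hTb, hFbr⟩ := hFb
  set F := Φ 1 * Fb
  set v := Ring.inverse (Φ 1)
  have hv : Φ 1 * v = 1 := h.mul_inv
  have hFv : F * v = Fb := by linear_combination Fb * hv
  -- the primitives of `Ψ_k F`
  let T : ℕ → R := fun k =>
    Nat.rec (db 1 F * v) (fun m x => db 1 x - S 1 (m + 1) * (db 1 F * v)) (k - 1)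
  have hT1 : T 1 = db 1 F * v := rfl
  have hTs : ∀ k, 1 ≤ k → db 1 (T k) = T (k + 1) + S 1 k * T 1 := fun k hk => by
    obtain ⟨m, rfl⟩ : ∃ m, k = m + 1 := ⟨k - 1, by omega⟩
    have : T (m + 1 + 1) = db 1 (T (m + 1)) - S 1 (m + 1) * T 1 := rfl
    rw [this]; ring
  have hF1 : db 1 F = Φ 1 * T 1 := by rw [hT1]; linear_combination (-db 1 F) * hv
  have hFs : ∀ s, 1 ≤ s → db s F = ∑ k ∈ Finset.Icc 1 s, Φ (s - k + 1) * T k := by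
    intro s hs
    have e1 := h.ghostZS_plusApply hF1 hTs s
    rw [hFv, ← hLb.2 s hs, plusApply_plus, ← hFb1 s hs, dlog] at e1
    have e2 : db s F = Φ 1 * db s Fb + Fb * db s (Φ 1) := by
      rw [Derivation.leibniz, smul_eq_mul, smul_eq_mul]
    rw [e2, e1]
    linear_combination (∑ k ∈ Finset.Icc 1 s, Φ (s - k + 1) * T k - db s (Φ 1) * Fb) * hv
  have hX1 : dt 1 (T 1) = Ψ 1 * F := by
    have e1 : dt 1 Fb = v * Tb 1 := by
      rw [hFbr 1 le_rfl]; simp [h.dualEigen_one, v]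
    have e2 : T 1 = db 1 Fb + Fb * (S 1 1 - Φ 2 * v) := by
      rw [hT1, Derivation.leibniz, h.db_one_Φ 1 le_rfl, smul_eq_mul, smul_eq_mul]
      linear_combination (db 1 Fb + Fb * S 1 1) * hv
    -- Equal to W₂/Φ₁; obtained from (L)₊ = D applied to Φ₁ and Φ₂.
    have e3 : dualAdj V Φ 1 = Φ 1 * dt 1 (Φ 2 * v) := by
      have a := h.sum_dualPrim hV hWV 1 (Φ 2)
      rw [Finset.Icc_self, Finset.sum_singleton, Nat.sub_self, zero_add, h.dualEigen_one,
        h.L_plusApply hV hWV hVW, h.L_plusApply hV hWV hVW] at a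
      rw [dualAdj, Derivation.leibniz, derivation_inverse _ h.isUnit_Φ, smul_eq_mul, smul_eq_mul]
      linear_combination Φ 1 * a - (dualPrim V Φ (Φ 2) 1) * hv
    have e4 : db 1 (dt 1 Fb) = Fb * dt 1 (Φ 2 * v) - db 1 (Φ 1) * v * dt 1 Fb := by
      rw [e1, Derivation.leibniz, hTb 1 le_rfl, e3, derivation_inverse _ h.isUnit_Φ, smul_eq_mul,
        smul_eq_mul]
      linear_combination (Fb * dt 1 (Φ 2 * v)) * hv
    rw [e2, map_add, h.htb 1 1 le_rfl le_rfl, e4, Derivation.leibniz _ Fb, map_sub,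
      h.hS 1 1 le_rfl le_rfl, h.db_one_Φ 1 le_rfl, smul_eq_mul, smul_eq_mul]
    linear_combination (-S 1 1 * dt 1 Fb) * hv
  have hX : ∀ k, 1 ≤ k → dt 1 (T k) = Ψ k * F := by
    intro k hk
    induction k, hk using Nat.le_induction with
    | base => exact hX1
    | succ k hk ih =>
      have e1 := congrArg (dt 1) (hTs k hk)
      rw [h.htb 1 1 le_rfl le_rfl, ih, map_add, Derivation.leibniz _ (Ψ k), Derivation.leibniz _ (S 1 k),
        hX1, hF1,
        h.hS 1 k le_rfl hk, h.db_one_Ψ k hk] at e1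
      simp only [smul_eq_mul] at e1
      linear_combination -e1
  refine ⟨?_, T, hX, hFs⟩
  -- the defect of the isospectral equations
  let E : ℕ → R := fun i => Tb i - dualPrim V Φ F i
  have hE : ∀ i, 1 ≤ i → db 1 (E i) = 0 := fun i hi => by
    have := h.db_one_dualPrim hWV hVW (F := F) (T := T 1) (G := 0) (by rw [hF1, add_zero]) hX1 i
    simp only [E]
    rw [map_sub, hTb i hi, this, hFv]
    simp [dualPrim, kernelCoeff, mulOp_zero]
  have hG : ∀ r, 1 ≤ r → dt r F - (L ^ r).plusApply F =
      ∑ i ∈ Finset.Icc 1 r, W.coeff (-(r - i : ℕ)) * E i := by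
    intro r hr
    have e1 := hFbr r hr
    have e2 := h.sum_dualPrim hV hWV r F
    have e3 : ∑ i ∈ Finset.Icc 1 r, W.coeff (-(r - i : ℕ)) * E i =
        Φ 1 * (dt r Fb - ∑ i ∈ Finset.Icc 1 r, dualEigen W Φ (r - i + 1) * dualPrim V Φ F i) := by
      rw [e1, ← Finset.sum_sub_distrib, Finset.mul_sum]
      refine Finset.sum_congr rfl fun i _ => ?_
      rw [← h.mul_dualEigen]
      simp only [E]; ring
    rw [e3, e2, ← h.hΦ 1 le_rfl r hr, Derivation.leibniz, smul_eq_mul, smul_eq_mul]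
    linear_combination (L ^ r).plusApply F * hv - Fb * dt r (Φ 1) * (Φ 1 * v + 1) * hv
  -- For r = 1 the eigenfunction equation is empty, since L₊ = D.
  have hE1 : E 1 = 0 := by
    have := hG 1 le_rfl
    rw [h.L_plusApply hV hWV hVW, sub_self, Finset.Icc_self, Finset.sum_singleton] at this
    simpa [h.hW.1] using this.symm
  -- Inserting the defect into `defect_equation` leaves a convolution of the coefficients of D⁻¹Ψ₁W
  -- with ∂E_i - E_{i+1}. It is triangular, with the unit Ψ₁ as leading coefficient.
  have hEs : ∀ i, 1 ≤ i → dt 1 (E i) - E (i + 1) = 0 := by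
    have hu : IsUnit (primCoeff W Ψ 1 1) := by rw [h.primCoeff_one]; exact h.isUnit_Ψ
    refine eq_zero_of_conv hu fun r hr => ?_
    have e1 := h.defect_equation hV hWV hVW hF1 hX1 (r + 1) (by omega)
    have e2 : v * db 1 (dt (r + 1) F - (L ^ (r + 1)).plusApply F) =
        ∑ i ∈ Finset.range (r + 1), primCoeff W Ψ 1 (r - i) * E (i + 1) := by
      rw [hG _ (by omega), sum_Icc_one, map_sum, Finset.mul_sum]
      refine Finset.sum_congr rfl fun i _ => ?_
      rw [Derivation.leibniz, hE _ (by omega), h.db_one_coeff, Nat.add_sub_add_right, smul_zero,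
        zero_add, smul_eq_mul]
      linear_combination (primCoeff W Ψ 1 (r - i) * E (i + 1)) * hv
    have e3 : dt 1 (∑ i ∈ Finset.range (r + 1), primCoeff W Ψ 1 (r - i) * E (i + 1)) =
        Ψ 1 * (∑ i ∈ Finset.range (r + 1), W.coeff (-(r - i : ℕ)) * E (i + 1)) +
        (∑ i ∈ Finset.range (r + 1), primCoeff W Ψ 1 (r - i) * dt 1 (E (i + 1)) -
          ∑ i ∈ Finset.range (r + 1), primCoeff W Ψ 1 (r + 1 - i) * E (i + 1)) := by
      rw [map_sum, Finset.mul_sum, ← Finset.sum_sub_distrib, ← Finset.sum_add_distrib]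
      refine Finset.sum_congr rfl fun i hi => ?_
      rw [Finset.mem_range] at hi
      have a := primCoeff_succ W Ψ 1 (r - i)
      rw [show r - i + 1 = r + 1 - i by omega] at a
      rw [a, Derivation.leibniz, smul_eq_mul, smul_eq_mul]
      ring
    rw [e2, e3, hG _ (by omega), sum_Icc_one] at e1
    simp only [Nat.add_sub_add_right, add_eq_left] at e1
    rw [Finset.sum_range_succ, Finset.sum_range_succ', Nat.sub_self, h.primCoeff_zero, zero_mul,
      add_zero, zero_add, hE1, mul_zero, add_zero, ← Finset.sum_sub_distrib] at e1
    rw [sum_Icc_conv, ← e1]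
    refine Finset.sum_congr rfl fun i _ => ?_
    rw [Nat.add_sub_add_right]
    ring
  have hE0 : ∀ i, 1 ≤ i → E i = 0 := by
    intro i hi
    induction i, hi using Nat.le_induction with
    | base => exact hE1
    | succ i hi ih =>
      have := hEs i hi
      rw [ih, map_zero, zero_sub, neg_eq_zero] at this
      exact this
  intro r hr
  rw [← sub_eq_zero, hG r hr]
  exact Finset.sum_eq_zero fun i hi => by rw [hE0 i (Finset.mem_Icc.1 hi).1, mul_zero]

end
end GhostSystem
end DoubleKP

/-! ### The proposition -/

open DoubleKP DoubleKP.PDO in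
theorem mainTheorem1 {R : Type*} [CommRing R] [Algebra ℚ R]
    -- `dt r = ∂/∂t_r` and `db s = ∂/∂t̄_s`, commuting
    (dt db : ℕ → Derivation ℤ R R)
    (htt : ∀ r s, 1 ≤ r → 1 ≤ s → ∀ f, dt r (dt s f) = dt s (dt r f))
    (hbb : ∀ r s, 1 ≤ r → 1 ≤ s → ∀ f, db r (db s f) = db s (db r f))
    (htb : ∀ r s, 1 ≤ r → 1 ≤ s → ∀ f, dt r (db s f) = db s (dt r f))
    -- the KP Lax operator `L = W D W⁻¹` with its dressing operator
    (W L : PDO (dt 1)) (hW : IsDressingForm W) (hL : L * W = W * D)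
    (hWt : ∀ r, 1 ≤ r → W.diff (dt r) = -((L ^ r).minus * W))
    -- (adjoint) eigenfunctions with invertible Wronskians, and primitives `S k j = ∂⁻¹(Φ_k Ψ_j)`
    (Φ Ψ : ℕ → R) (S : ℕ → ℕ → R)
    (hΦ : ∀ k, 1 ≤ k → IsEigenfunction dt L (Φ k))
    (hΨ : ∀ k, 1 ≤ k → IsAdjEigenfunction dt L (Ψ k))
    (hΦwr : ∀ k, 1 ≤ k → IsUnit (wr (dt 1) Φ k))
    (hΨwr : ∀ k, 1 ≤ k → IsUnit (wr (dt 1) Ψ k))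
    (hS : ∀ k j, 1 ≤ k → 1 ≤ j → dt 1 (S k j) = Φ k * Ψ j)
    -- the ghost flows
    (hWb : ∀ s, 1 ≤ s → W.diff (db s) = ghostGenerator (dt 1) Φ Ψ s * W)
    (hΦb : ∀ s k, 1 ≤ s → 1 ≤ k →
      db s (Φ k) = ∑ j ∈ Finset.Icc 1 s, Φ (s - j + 1) * S k j - Φ (k + s))
    (hΨb : ∀ s k, 1 ≤ s → 1 ≤ k →
      db s (Ψ k) = ∑ j ∈ Finset.Icc 1 s, Ψ j * S (s - j + 1) k + Ψ (k + s)) :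
    (∃! Lbar : PDO (db 1), IsGhostLax dt db Φ Ψ Lbar) ∧
    ∀ Lbar : PDO (db 1), IsGhostLax dt db Φ Ψ Lbar →
      ∃ Φbar Ψbar : ℕ → R,
        -- `Φ̄_l`, `Ψ̄_j`; the constants of integration in `Φ̄_l` are fixed by `Φ₁ Φ̄_{l+1} = w_l`
        IsDualSystem (dt 1) (db 1) Φ Ψ Φbar Ψbar ∧
        (∀ l : ℕ, Φ 1 * Φbar (l + 1) = W.coeff (-(l : ℤ))) ∧
        (∀ l, 1 ≤ l → IsEigenfunction db Lbar (Φbar l)) ∧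
        (∀ j, 1 ≤ j → IsAdjEigenfunction db Lbar (Ψbar j)) ∧
        -- the Lax equations
        (∀ r, 1 ≤ r → L.diff (dt r) = comm (L ^ r).plus L) ∧
        (∀ s, 1 ≤ s → L.diff (db s) = comm (ghostGenerator (dt 1) Φ Ψ s) L) ∧
        (∀ s, 1 ≤ s → Lbar.diff (db s) = comm (Lbar ^ s).plus Lbar) ∧
        (∀ r, 1 ≤ r → Lbar.diff (dt r) = comm (ghostGenerator (db 1) Φbar Ψbar r) Lbar) ∧
        -- generic eigenfunctions `F` of `L` and `F̄` of `L̄`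
        (∀ F, IsGenericEigenfunction dt db L Φ Ψ F →
          IsGenericEigenfunction db dt Lbar Φbar Ψbar (F * Ring.inverse (Φ 1))) ∧
        (∀ Fbar, IsGenericEigenfunction db dt Lbar Φbar Ψbar Fbar →
          IsGenericEigenfunction dt db L Φ Ψ (Φ 1 * Fbar)) := by
  have h : GhostSystem dt db W L Φ Ψ S :=
    ⟨htt, hbb, htb, hW, hL, hWt, hΦ, hΨ, hΦwr, hΨwr, hS, hWb, hΦb, hΨb⟩
  obtain ⟨V, hV, hWV, hVW⟩ := exists_inverse hW
  obtain ⟨Vb, hVb, hWVb, hVWb⟩ := exists_inverse h.isDressingForm_ghostDressing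
  refine ⟨⟨_, h.isGhostLax_dressing hVb hWVb hVWb,
    fun Lb hLb => h.eq_dressing_of_isGhostLax hVb hWVb hVWb hLb⟩, fun Lb hLb => ?_⟩
  have hLW : Lb * GhostSystem.ghostDressing (db 1) Φ = GhostSystem.ghostDressing (db 1) Φ * D := by
    rw [h.eq_dressing_of_isGhostLax hVb hWVb hVWb hLb, mul_assoc, hVWb, mul_one]
  exact ⟨GhostSystem.dualEigen W Φ, GhostSystem.dualAdj V Φ, h.isDualSystem hV hWV hVW,
    h.mul_dualEigen, fun l _ => h.isEigenfunction_dualEigen hLb l,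
    fun j hj => h.isAdjEigenfunction_dualAdj hV hWV hVW hWVb hLb j hj,
    fun r hr => h.lax_dt hWV r hr, fun s hs => h.lax_db hWV s hs,
    fun s hs => h.ghostLax_db hWVb hLb hLW s hs,
    fun r hr => diff_lax (fun f => htb r 1 hr le_rfl f) hWVb hLW
      (h.diff_ghostDressing hV hWV hVW r hr),
    fun F hF => h.isGeneric_div hV hWV hVW hLb hF,
    fun Fb hFb => h.isGeneric_mul hV hWV hVW hLb hFb⟩
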